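/- Let $c\ge 0$, let $\mathbb H_c=L^2(\mathbb R,e^{-2ct}\,dt)$ (complex-valued functions), and let $\partial_c f=f'$ be the differentiation operator on $\mathbb H_c$ with domain $D(\partial_c)=\{f\in\mathbb H_c: f \text{ locally absolutely continuous on }\mathbb R,\ f'\in\mathbb H_c\}$. Put $V_c=(\partial_c-c)/i$, a self-adjoint operator on $\mathbb H_c$, so that $\partial_c=c+iV_c$. For every $T>0$ let $\phi^{(T)}:\mathbb R\to\mathbb R$ be any $T$-admissible cut-off function, that is, a continuous function such that the closure of $\phi^{(T)}(\mathbb R)$ is $[-T,T]$ and, if $c=1$, such that $\phi^{(T)}$ is moreover the restriction to $\mathbb R$ of a meromorphic function on an open neighborhood of $\mathbb R$ in $\mathbb C$. Using the measurable functional calculus for (possibly unbounded) normal operators, define the truncated operators $$\partial_c^{(T)}=c+i\,\phi^{(T)}(V_c),\qquad \mathfrak a_c^{(T)}=\zeta\big(\partial_c^{(T)}\big),$$ where $\zeta$ is the Riemann zeta function. (For $c=1$ the value assigned to $\zeta$ at its pole $s=1$ is irrelevant, since $1$ is not an eigenvalue of $\partial_1^{(T)}$.) The spectral operator $\mathfrak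 a_c=\zeta(\partial_c)$ is called quasi-invertible if for every $T>0$ the operator $\mathfrak a_c^{(T)}$ is invertible, i.e. is a bijection from its domain onto $\mathbb H_c$ with bounded inverse. Then $\mathfrak a_c$ is quasi-invertible if and only if $\zeta(s)\neq 0$ for all $s\in\mathbb C$ with $\operatorname{Re}s=c$. -/

import Mathlib

open MeasureTheory Set
open scoped ENNReal InnerProductSpace

noncomputable section

/-! ### Spectral measures and the measurable functional calculus -/

section FunctionalCalculus

variable {H : Type*} [NormedAddCommGroup H] [InnerProductSpace ℂ H] [CompleteSpace H]

/-- A spectral measure (resolution of the identity) on the Borel sets of `ℂ`: a countably additive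
family of orthogonal projections of the Hilbert space `H`, multiplicative on intersections, with
total mass the identity. Only the values on Borel sets matter. -/
structure SpectralMeasure (H : Type*) [NormedAddCommGroup H] [InnerProductSpace ℂ H]
    [CompleteSpace H] where
  proj : Set ℂ → H →L[ℂ] H
  isStarProjection : ∀ s, MeasurableSet s → IsStarProjection (proj s)
  proj_univ : proj univ = 1
  proj_inter : ∀ s t, MeasurableSet s → MeasurableSet t → proj (s ∩ t) = proj s * proj t
  hasSum_proj : ∀ s : ℕ → Set ℂ, (∀ n, MeasurableSet (s n)) → Pairwise (Function.onFun Disjoint s) →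
    ∀ x, HasSum (fun n => proj (s n) x) (proj (⋃ n, s n) x)

namespace SpectralMeasure

variable (E : SpectralMeasure H)

theorem proj_empty : E.proj ∅ = 0 := by
  ext x
  have h := E.hasSum_proj (fun _ => ∅) (fun _ => MeasurableSet.empty)
    (fun _ _ _ => by simp [Function.onFun]) x
  simpa using (summable_const_iff (β := ℕ) _).1 h.summable

theorem inner_proj_re {s : Set ℂ} (hs : MeasurableSet s) (x : H) :
    (⟪x, E.proj s x⟫_ℂ).re = ‖E.proj s x‖ ^ 2 := by
  have hp := E.isStarProjection s hs
  have h1 : E.proj s x = E.proj s (E.proj s x) := by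
    have := congrArg (fun T : H →L[ℂ] H => T x) hp.isIdempotentElem.eq
    simpa using this.symm
  have h2 : ⟪x, E.proj s x⟫_ℂ = ⟪E.proj s x, E.proj s x⟫_ℂ := by
    conv_lhs => rw [h1]
    rw [← ContinuousLinearMap.adjoint_inner_left,
      ← ContinuousLinearMap.star_eq_adjoint, hp.isSelfAdjoint.star_eq]
  rw [h2, inner_self_eq_norm_sq_to_K]
  norm_cast

/-- The scalar spectral measure `s ↦ ⟪x, E(s) x⟫ = ‖E(s) x‖²` of the vector `x`. -/
def scalarMeasure (x : H) : Measure ℂ :=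
  Measure.ofMeasurable (fun s _ => ENNReal.ofReal (⟪x, E.proj s x⟫_ℂ).re)
    (by simp [E.proj_empty])
    (by
      intro s hs hd
      have h := E.hasSum_proj s hs hd x
      have h1 : HasSum (fun n => ⟪x, E.proj (s n) x⟫_ℂ) ⟪x, E.proj (⋃ n, s n) x⟫_ℂ :=
        h.mapL (innerSL ℂ x)
      have h2 : HasSum (fun n => (⟪x, E.proj (s n) x⟫_ℂ).re)
          (⟪x, E.proj (⋃ n, s n) x⟫_ℂ).re := Complex.hasSum_re h1
      rw [← h2.tsum_eq]
      refine ENNReal.ofReal_tsum_of_nonneg (fun n => ?_) h2.summable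
      rw [E.inner_proj_re (hs n)]
      positivity)

/-- `B` is the operator `∫ f dE`: its domain consists of the `x` with `∫ |f|² dE_{x,x} < ∞`, and
`⟪x, B x⟫ = ∫ f dE_{x,x}` there. By polarization and the linearity of `B` on this dense domain,
`B` is determined by its quadratic form, and `⟪y, B x⟫ = ∫ f dE_{y,x}`. -/
def IsIntegral (f : ℂ → ℂ) (B : H →ₗ.[ℂ] H) : Prop :=
  (∀ x, x ∈ B.domain ↔ MemLp f 2 (E.scalarMeasure x)) ∧
    ∀ x : B.domain, ⟪(x : H), B x⟫_ℂ = ∫ z, f z ∂(E.scalarMeasure (x : H))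

end SpectralMeasure

/-- `B = f(A)` in the sense of the measurable functional calculus for (possibly unbounded) normal
operators: `A = ∫ z dE(z)` and `B = ∫ f(z) dE(z)` for the spectral measure `E` of `A`. -/
def IsFunctionOf (A : H →ₗ.[ℂ] H) (f : ℂ → ℂ) (B : H →ₗ.[ℂ] H) : Prop :=
  ∃ E : SpectralMeasure H, E.IsIntegral id A ∧ E.IsIntegral f B

open Classical in
/-- The operator `f(A)`, for `A` normal and `f` a Borel function. The value `⊥` (the operator with
domain `{0}`) is used when `A` has no spectral measure. -/
def functionalCalculus (A : H →ₗ.[ℂ] H) (f : ℂ → ℂ) : H →ₗ.[ℂ] H :=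
  if h : ∃ B, IsFunctionOf A f B then h.choose else ⊥

/-- A (possibly unbounded) operator is invertible if it is a bijection from its domain onto `H`
with bounded, everywhere defined inverse. -/
def IsInvertibleOperator (A : H →ₗ.[ℂ] H) : Prop :=
  ∃ B : H →L[ℂ] H, (∀ u, ∃ h : B u ∈ A.domain, A ⟨B u, h⟩ = u) ∧ ∀ v : A.domain, B (A v) = v

/-- Multiplication by the scalar `z` on all of `H`. -/
def scalarOperator (H : Type*) [NormedAddCommGroup H] [InnerProductSpace ℂ H] (z : ℂ) :
    H →ₗ.[ℂ] H :=
  (z • (LinearMap.id : H →ₗ[ℂ] H)).toPMap ⊤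

end FunctionalCalculus

/-! ### The weighted Hilbert space and the infinitesimal shift -/

/-- The measure `e^{-2ct} dt` on the real line. -/
def weightMeasure (c : ℝ) : Measure ℝ :=
  volume.withDensity fun t => ENNReal.ofReal (Real.exp (-2 * c * t))

/-- The Hilbert space `L²(ℝ, e^{-2ct} dt)`. -/
abbrev WeightedSpace (c : ℝ) : Type := Lp ℂ 2 (weightMeasure c)

theorem weightMeasure_absolutelyContinuous (c : ℝ) : weightMeasure c ≪ volume :=
  withDensity_absolutelyContinuous _ _

theorem absolutelyContinuous_weightMeasure (c : ℝ) : volume ≪ weightMeasure c := by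
  refine withDensity_absolutelyContinuous' (by fun_prop) (Filter.Eventually.of_forall fun t => ?_)
  simpa using Real.exp_pos _

/-- `g` is (locally) absolutely continuous on the real line. -/
def LocallyAbsolutelyContinuous (g : ℝ → ℂ) : Prop :=
  ∀ a b : ℝ, AbsolutelyContinuousOnInterval g a b

namespace LocallyAbsolutelyContinuous

theorem continuous {g : ℝ → ℂ} (hg : LocallyAbsolutelyContinuous g) : Continuous g := by
  rw [continuous_iff_continuousAt]
  intro x
  refine (hg (x - 1) (x + 1)).continuousOn.continuousAt ?_
  rw [uIcc_of_le (by linarith)]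
  exact Icc_mem_nhds (by linarith) (by linarith)

theorem ae_differentiableAt {g : ℝ → ℂ} (hg : LocallyAbsolutelyContinuous g) :
    ∀ᵐ t, DifferentiableAt ℝ g t := by
  have hl : LocallyBoundedVariationOn g univ := by
    intro a b _ _
    refine (hg a b).boundedVariationOn.mono ?_
    exact inter_subset_right.trans Icc_subset_uIcc
  exact hl.ae_differentiableAt

end LocallyAbsolutelyContinuous

/-- The graph of the differentiation operator: pairs `(f, f')` with `f` (the class of) a locally
absolutely continuous function, `f` and `f'` both in `L²(ℝ, e^{-2ct} dt)`. -/
def shiftGraph (c : ℝ) : Submodule ℂ (WeightedSpace c × WeightedSpace c) where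
  carrier := {p | ∃ g : ℝ → ℂ, LocallyAbsolutelyContinuous g ∧
    p.1 =ᵐ[weightMeasure c] g ∧ p.2 =ᵐ[weightMeasure c] deriv g}
  add_mem' := by
    rintro p q ⟨g, hg, hg1, hg2⟩ ⟨k, hk, hk1, hk2⟩
    refine ⟨g + k, fun a b => (hg a b).add (hk a b), ?_, ?_⟩
    · exact (Lp.coeFn_add _ _).trans (hg1.add hk1)
    · have hd : deriv (g + k) =ᵐ[weightMeasure c] deriv g + deriv k := by
        refine (weightMeasure_absolutelyContinuous c).ae_le ?_
        filter_upwards [hg.ae_differentiableAt, hk.ae_differentiableAt] with t h1 h2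
        exact deriv_add h1 h2
      exact (Lp.coeFn_add _ _).trans ((hg2.add hk2).trans hd.symm)
  zero_mem' := by
    refine ⟨0, fun a b => ?_, Lp.coeFn_zero _ _ _, ?_⟩
    · exact (LipschitzOnWith.absolutelyContinuousOnInterval (K := 0)
        ((LipschitzWith.const (0 : ℂ)).lipschitzOnWith))
    · have : deriv (0 : ℝ → ℂ) = 0 := by ext; simp
      rw [this]
      exact Lp.coeFn_zero _ _ _
  smul_mem' := by
    rintro z p ⟨g, hg, hg1, hg2⟩
    refine ⟨z • g, fun a b => ?_, ?_, ?_⟩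
    · exact (hg a b).const_smul z
    · exact (Lp.coeFn_smul _ _).trans (hg1.const_smul z)
    · have hd : deriv (z • g) = z • deriv g := by
        ext t
        exact deriv_const_smul_field z g
      rw [hd]
      exact (Lp.coeFn_smul _ _).trans (hg2.const_smul z)

theorem shiftGraph_functional (c : ℝ) (p : WeightedSpace c × WeightedSpace c)
    (hp : p ∈ shiftGraph c) (h0 : p.1 = 0) : p.2 = 0 := by
  obtain ⟨g, hg, hg1, hg2⟩ := hp
  have h1 : g =ᵐ[weightMeasure c] (0 : ℝ → ℂ) := by
    rw [h0] at hg1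
    exact hg1.symm.trans (Lp.coeFn_zero _ _ _)
  have h2 : g = 0 := Continuous.ae_eq_iff_eq volume hg.continuous continuous_zero |>.1
    ((absolutelyContinuous_weightMeasure c).ae_le h1)
  have h3 : deriv g = 0 := by rw [h2]; ext; simp
  rw [h3] at hg2
  exact Lp.ext (hg2.trans (Lp.coeFn_zero _ _ _).symm)

/-- The infinitesimal shift `∂_c f = f'`, with domain the `f ∈ L²(ℝ, e^{-2ct} dt)` that are locally
absolutely continuous with `f' ∈ L²(ℝ, e^{-2ct} dt)`. -/
def infinitesimalShift (c : ℝ) : WeightedSpace c →ₗ.[ℂ] WeightedSpace c :=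
  (shiftGraph c).toLinearPMap

theorem infinitesimalShift_graph (c : ℝ) : (infinitesimalShift c).graph = shiftGraph c :=
  Submodule.toLinearPMap_graph_eq _ fun p hp h0 => shiftGraph_functional c p hp h0

/-- The self-adjoint operator `V_c = (∂_c - c) / i`, so that `∂_c = c + i V_c`. -/
def momentumOperator (c : ℝ) : WeightedSpace c →ₗ.[ℂ] WeightedSpace c :=
  Complex.I⁻¹ • (infinitesimalShift c - scalarOperator (WeightedSpace c) c)

/-! ### Truncations and quasi-invertibility -/

/-- `φ` is a `T`-admissible cut-off function: it is continuous on `ℝ` and the closure of its range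
is `[-T, T]`; when `c = 1` it is moreover the restriction to `ℝ` of a meromorphic function on an
open neighborhood of `ℝ` in `ℂ`. -/
def IsAdmissibleCutoff (c T : ℝ) (φ : ℝ → ℝ) : Prop :=
  Continuous φ ∧ closure (range φ) = Icc (-T) T ∧
    (c = 1 → ∃ (U : Set ℂ) (Φ : ℂ → ℂ), IsOpen U ∧ (∀ x : ℝ, (x : ℂ) ∈ U) ∧
      MeromorphicOn Φ U ∧ ∀ x : ℝ, Φ x = φ x)

/-- The truncated infinitesimal shift `c + i φ(V_c)`. As `V_c` is self-adjoint, its spectral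
measure is carried by the real line, so that `φ` may be extended to `ℂ` by `z ↦ φ (Re z)`. -/
def truncatedShift (c : ℝ) (φ : ℝ → ℝ) : WeightedSpace c →ₗ.[ℂ] WeightedSpace c :=
  scalarOperator (WeightedSpace c) c +
    Complex.I • functionalCalculus (momentumOperator c) (fun z => (φ z.re : ℂ))

/-- The truncated spectral operator `ζ(c + i φ(V_c))`. -/
def truncatedSpectralOperator (c : ℝ) (φ : ℝ → ℝ) : WeightedSpace c →ₗ.[ℂ] WeightedSpace c :=
  functionalCalculus (truncatedShift c φ) riemannZeta

/-- Quasi-invertibility of the spectral operator `ζ(∂_c)`, with truncations formed with the family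
of cut-off functions `φ T`, `T > 0`: every truncation is invertible. -/
def IsQuasiInvertible (c : ℝ) (φ : ℝ → ℝ → ℝ) : Prop :=
  ∀ T : ℝ, 0 < T → IsInvertibleOperator (truncatedSpectralOperator c (φ T))

end

noncomputable section

open Filter Topology

/-! Multiplication by `e^{-ct}` maps the weighted space unitarily onto `L²(ℝ)` and turns `∂_c - c`
into `d/dt`; the Fourier transform then turns `V_c` into multiplication by `2πξ`
(`isIntegral_momentumOperator`). Hence `V_c` has a spectral measure, and every real number lies in
its spectrum. Since `φ` is continuous with range dense in `[-T, T]`, the spectrum of `c + iφ(V_c)`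
is exactly the compact segment `c + i[-T, T]`.

If `ζ` has no zero on the line, it is bounded away from `0` on each such segment: it is continuous
off `1`, and large near its pole. Then `∫ ζ⁻¹ dE` is a bounded inverse. If `ζ(s) = 0` with `Re s =
c`, choose `T` so large that `s` lies on the segment; continuity of `ζ` at `s` makes `0` an
approximate eigenvalue of `ζ(c + iφ(V_c))`, which excludes a bounded inverse.

The functional calculus is defined by choosing some spectral measure of the operator, and
consecutive choices need not be visibly related. Uniqueness of spectral measures is not needed:
`SpectralMeasure.IsIntegral.hasApproximateEigenvalue_iff` describes the support of any spectral
measure of `A` through approximate eigenvalues, a notion that depends on `A` alone. All information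
passes between spectral measures through this equivalence. -/

theorem LinearPMap.eq_of_inner_self_eq {H : Type*} [NormedAddCommGroup H]
    [InnerProductSpace ℂ H] {A B : H →ₗ.[ℂ] H} (hd : A.domain = B.domain)
    (hdense : Dense (A.domain : Set H))
    (h : ∀ (x : H) (hA : x ∈ A.domain) (hB : x ∈ B.domain),
      ⟪x, A ⟨x, hA⟩⟫_ℂ = ⟪x, B ⟨x, hB⟩⟫_ℂ) : A = B := by
  obtain ⟨D, A⟩ := A
  obtain ⟨D', B⟩ := B
  obtain rfl : D = D' := hd
  refine LinearPMap.ext rfl fun x hx hx' => ?_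
  let C : D →ₗ[ℂ] H := A - B
  have hC : ∀ x : D, ⟪(x : H), C x⟫_ℂ = 0 := by
    intro x
    have := h x x.2 x.2
    simp only [C, LinearMap.sub_apply, inner_sub_right, sub_eq_zero]
    exact this
  -- Complex polarization: the vanishing of the form at `x + y` and at `x + iy` gives the sum and
  -- the difference of the two cross terms.
  have hpol : ∀ x y : D, ⟪(y : H), C x⟫_ℂ = 0 := by
    intro x y
    have h1 := hC (x + y)
    have h2 := hC (x + Complex.I • y)
    simp only [_root_.map_add, Submodule.coe_add, inner_add_left, inner_add_right, hC, _root_.map_smul,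
      Submodule.coe_smul, inner_smul_left, inner_smul_right, Complex.conj_I] at h1 h2
    have h3 : Complex.I * (Complex.I * ⟪(x : H), C y⟫_ℂ + -Complex.I * ⟪(y : H), C x⟫_ℂ) = 0 := by
      linear_combination Complex.I * h2
    linear_combination (1 / 2 : ℂ) * h3 + (1 / 2 : ℂ) * h1 -
      (1 / 2 : ℂ) * (⟪(x : H), C y⟫_ℂ - ⟪(y : H), C x⟫_ℂ) * Complex.I_mul_I
  have hz : C ⟨x, hx⟩ = 0 := by
    refine hdense.eq_zero_of_inner_right (𝕜 := ℂ) fun y hy => ?_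
    exact hpol ⟨x, hx⟩ ⟨y, hy⟩
  exact sub_eq_zero.1 hz

namespace SpectralMeasure

variable {H : Type*} [NormedAddCommGroup H] [InnerProductSpace ℂ H] [CompleteSpace H]
  (E : SpectralMeasure H)

/-! ### Spectral projections and scalar measures -/

theorem proj_proj {s t : Set ℂ} (hs : MeasurableSet s) (ht : MeasurableSet t) (x : H) :
    E.proj s (E.proj t x) = E.proj (s ∩ t) x := by
  rw [E.proj_inter s t hs ht]; rfl

theorem inner_proj_left {s : Set ℂ} (hs : MeasurableSet s) (x y : H) :
    ⟪E.proj s x, y⟫_ℂ = ⟪x, E.proj s y⟫_ℂ := by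
  rw [← ContinuousLinearMap.adjoint_inner_right, ← ContinuousLinearMap.star_eq_adjoint,
    (E.isStarProjection s hs).isSelfAdjoint.star_eq]

theorem proj_union {s t : Set ℂ} (hs : MeasurableSet s) (ht : MeasurableSet t)
    (hd : Disjoint s t) : E.proj (s ∪ t) = E.proj s + E.proj t := by
  ext x
  let u : ℕ → Set ℂ := fun n => if n = 0 then s else if n = 1 then t else ∅
  have hu : ⋃ n, u n = s ∪ t := by
    apply subset_antisymm
    · refine iUnion_subset fun n => ?_
      simp only [u]
      split_ifs <;> simp
    · exact union_subset (subset_iUnion u 0) (subset_iUnion u 1)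
  have h := E.hasSum_proj u (fun n => by simp only [u]; split_ifs <;> simp [hs, ht]) (by
    intro m n hmn
    simp only [Function.onFun, u]
    split_ifs <;> simp_all [hd.symm]) x
  have h2 : HasSum (fun n => E.proj (u n) x) (∑ n ∈ Finset.range 2, E.proj (u n) x) := by
    refine hasSum_sum_of_ne_finset_zero fun n hn => ?_
    have : 1 < n := by simpa using hn
    simp [u, show n ≠ 0 by omega, show n ≠ 1 by omega, E.proj_empty]
  rw [hu] at h
  rw [h.unique h2]
  simp [Finset.sum_range_succ, u]

theorem proj_compl {s : Set ℂ} (hs : MeasurableSet s) (x : H) :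
    E.proj sᶜ x = x - E.proj s x := by
  have h := E.proj_union hs hs.compl disjoint_compl_right
  rw [union_compl_self, E.proj_univ] at h
  have := congrArg (fun T : H →L[ℂ] H => T x) h
  simp only [_root_.add_apply, one_apply_eq_self] at this
  rw [eq_sub_iff_add_eq, add_comm, ← this]

theorem proj_biUnion {ι : Type*} (F : Finset ι) (s : ι → Set ℂ) (hs : ∀ i, MeasurableSet (s i))
    (hd : Pairwise (Function.onFun Disjoint s)) :
    E.proj (⋃ i ∈ F, s i) = ∑ i ∈ F, E.proj (s i) := by
  classical
  induction F using Finset.induction_on with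
  | empty => simp [E.proj_empty]
  | insert a F ha ih =>
    rw [Finset.set_biUnion_insert, E.proj_union (hs a) (F.measurableSet_biUnion fun i _ => hs i),
      Finset.sum_insert ha, ih]
    rw [disjoint_iUnion₂_right]
    exact fun i hi => hd (by rintro rfl; exact ha hi)

theorem scalarMeasure_apply {s : Set ℂ} (hs : MeasurableSet s) (x : H) :
    E.scalarMeasure x s = ‖E.proj s x‖ₑ ^ 2 := by
  rw [scalarMeasure, Measure.ofMeasurable_apply s hs, E.inner_proj_re hs,
    ENNReal.ofReal_pow (norm_nonneg _), ofReal_norm]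

theorem scalarMeasure_univ (x : H) : E.scalarMeasure x univ = ‖x‖ₑ ^ 2 := by
  rw [E.scalarMeasure_apply MeasurableSet.univ, E.proj_univ]; rfl

instance (x : H) : IsFiniteMeasure (E.scalarMeasure x) :=
  ⟨by rw [scalarMeasure_univ]; exact ENNReal.pow_lt_top enorm_lt_top⟩

theorem scalarMeasure_real {s : Set ℂ} (hs : MeasurableSet s) (x : H) :
    ((E.scalarMeasure x).real s : ℂ) = ⟪x, E.proj s x⟫_ℂ := by
  have h1 : ⟪x, E.proj s x⟫_ℂ = ⟪E.proj s x, E.proj s x⟫_ℂ := by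
    rw [E.inner_proj_left hs, E.proj_proj hs hs, inter_self]
  rw [Measure.real, E.scalarMeasure_apply hs, h1, inner_self_eq_norm_sq_to_K]
  simp

theorem scalarMeasure_smul (a : ℂ) (x : H) :
    E.scalarMeasure (a • x) = (‖a‖ₑ ^ 2) • E.scalarMeasure x := by
  ext s hs
  rw [Measure.smul_apply, E.scalarMeasure_apply hs, E.scalarMeasure_apply hs, map_smul, enorm_smul,
    mul_pow, smul_eq_mul]

/-- This domination, an instance of `(a + b)² ≤ 2(a² + b²)`, makes square integrability of `f`
stable under addition of vectors, so that the domain of `∫ f dE` is a subspace. -/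
theorem scalarMeasure_add_le (x y : H) :
    E.scalarMeasure (x + y) ≤ (2 : ℝ≥0∞) • (E.scalarMeasure x + E.scalarMeasure y) := by
  refine Measure.le_iff.2 fun s hs => ?_
  rw [Measure.smul_apply, Measure.add_apply, E.scalarMeasure_apply hs, E.scalarMeasure_apply hs,
    E.scalarMeasure_apply hs, map_add, smul_eq_mul]
  calc ‖E.proj s x + E.proj s y‖ₑ ^ 2 ≤ (‖E.proj s x‖ₑ + ‖E.proj s y‖ₑ) ^ 2 := by
        gcongr; exact enorm_add_le _ _
    _ ≤ _ := by
        have := ENNReal.rpow_add_le_mul_rpow_add_rpow ‖E.proj s x‖ₑ ‖E.proj s y‖ₑ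
          (p := 2) (by norm_num)
        norm_num at this
        exact this

theorem scalarMeasure_proj {s : Set ℂ} (hs : MeasurableSet s) (x : H) :
    E.scalarMeasure (E.proj s x) = (E.scalarMeasure x).restrict s := by
  ext t ht
  rw [E.scalarMeasure_apply ht, Measure.restrict_apply ht, E.scalarMeasure_apply (ht.inter hs),
    E.proj_proj ht hs]

/-! ### Integrals of simple functions -/

/-- The integral of a simple function against a spectral measure. -/
def simpleIntegral (g : SimpleFunc ℂ ℂ) : H →L[ℂ] H :=
  ∑ v ∈ g.range, v • E.proj (g ⁻¹' {v})

/-- The integral may be computed on a partition finer than the level sets. Applied to `g.pair h`,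
this gives a common refinement for two simple functions. -/
theorem simpleIntegral_map {β : Type*} (p : SimpleFunc ℂ β) (F : β → ℂ) :
    E.simpleIntegral (p.map F) = ∑ b ∈ p.range, F b • E.proj (p ⁻¹' {b}) := by
  classical
  rw [simpleIntegral, SimpleFunc.range_map]
  refine Finset.sum_image' _ fun b _ => ?_
  have h : (p.map F) ⁻¹' {F b} = ⋃ i ∈ p.range.filter (fun i => F i = F b), p ⁻¹' {i} := by
    ext z
    simp
  rw [h, E.proj_biUnion _ _ (fun i => p.measurableSet_fiber i), Finset.smul_sum]
  · refine Finset.sum_congr rfl fun i hi => ?_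
    rw [(Finset.mem_filter.1 hi).2]
  · intro i j hij
    exact Disjoint.preimage _ (by simpa using hij)

theorem simpleIntegral_sub (g h : SimpleFunc ℂ ℂ) :
    E.simpleIntegral (g - h) = E.simpleIntegral g - E.simpleIntegral h := by
  have h1 := E.simpleIntegral_map (g.pair h) Prod.fst
  have h2 := E.simpleIntegral_map (g.pair h) Prod.snd
  have h3 := E.simpleIntegral_map (g.pair h) (fun p => p.1 - p.2)
  rw [SimpleFunc.map_fst_pair] at h1
  rw [SimpleFunc.map_snd_pair] at h2
  rw [show g - h = (g.pair h).map (fun p => p.1 - p.2) from rfl, h1, h2, h3,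
    ← Finset.sum_sub_distrib]
  simp [sub_smul]

theorem simpleIntegral_mul (g h : SimpleFunc ℂ ℂ) :
    E.simpleIntegral (g * h) = E.simpleIntegral g * E.simpleIntegral h := by
  classical
  have h3 := E.simpleIntegral_map (g.pair h) (fun p => p.1 * p.2)
  rw [show g * h = (g.pair h).map (fun p => p.1 * p.2) from rfl, h3, simpleIntegral,
    simpleIntegral, Finset.sum_mul_sum, ← Finset.sum_product']
  have h4 : ∀ p : ℂ × ℂ, (g.pair h) ⁻¹' {p} = g ⁻¹' {p.1} ∩ h ⁻¹' {p.2} := by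
    intro p
    ext z
    simp [Prod.ext_iff]
  have h5 : ∀ p : ℂ × ℂ, (p.1 * p.2) • E.proj ((g.pair h) ⁻¹' {p}) =
      (p.1 • E.proj (g ⁻¹' {p.1})) * (p.2 • E.proj (h ⁻¹' {p.2})) := by
    intro p
    rw [h4, E.proj_inter _ _ (g.measurableSet_fiber _) (h.measurableSet_fiber _), smul_mul_smul_comm]
  simp only [← h5]
  -- The pair takes only some of the values in the product of the two ranges; the others have empty
  -- fibre, hence zero projection.
  refine Finset.sum_subset ?_ ?_
  · intro p hp
    obtain ⟨z, rfl⟩ := SimpleFunc.mem_range.1 hp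
    simp
  · intro p _ hp
    have : (g.pair h) ⁻¹' {p} = ∅ := by
      rw [Set.preimage_singleton_eq_empty]
      exact fun hh => hp (SimpleFunc.mem_range.2 hh)
    rw [this, E.proj_empty, smul_zero]

theorem inner_simpleIntegral (g : SimpleFunc ℂ ℂ) (x : H) :
    ⟪x, E.simpleIntegral g x⟫_ℂ = ∫ z, g z ∂(E.scalarMeasure x) := by
  rw [SimpleFunc.integral_eq_sum g (g.integrable_of_isFiniteMeasure), simpleIntegral,
    _root_.sum_apply, inner_sum]
  refine Finset.sum_congr rfl fun v _ => ?_
  rw [_root_.smul_apply, inner_smul_right,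
    ← E.scalarMeasure_real (g.measurableSet_fiber v), mul_comm]
  simp

/-- Pythagoras: distinct values have disjoint fibres, whose projections have orthogonal ranges. -/
theorem norm_simpleIntegral_sq (g : SimpleFunc ℂ ℂ) (x : H) :
    ‖E.simpleIntegral g x‖ ^ 2 = ∑ v ∈ g.range, ‖v‖ ^ 2 * ‖E.proj (g ⁻¹' {v}) x‖ ^ 2 := by
  rw [simpleIntegral, _root_.sum_apply]
  have h : (∑ v ∈ g.range, (v • E.proj (g ⁻¹' {v})) x) = ∑ v ∈ g.range,
    v • E.proj (g ⁻¹' {v}) x := rfl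
  rw [h]
  have key : ∀ F : Finset ℂ, ‖∑ v ∈ F, v • E.proj (g ⁻¹' {v}) x‖ ^ 2 =
      ∑ v ∈ F, ‖v‖ ^ 2 * ‖E.proj (g ⁻¹' {v}) x‖ ^ 2 := by
    intro F
    induction F using Finset.induction_on with
    | empty => simp
    | insert a F ha ih =>
      rw [Finset.sum_insert ha, Finset.sum_insert ha, ← ih, pow_two ‖_ + _‖,
        norm_add_sq_eq_norm_sq_add_norm_sq_of_inner_eq_zero (𝕜 := ℂ), norm_smul]
      · ring
      · rw [inner_sum]
        refine Finset.sum_eq_zero fun v hv => ?_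
        rw [inner_smul_left, inner_smul_right, E.inner_proj_left (g.measurableSet_fiber a),
          E.proj_proj (g.measurableSet_fiber a) (g.measurableSet_fiber v),
          ← Set.preimage_inter, Set.singleton_inter_eq_empty.2, Set.preimage_empty, E.proj_empty]
        · simp
        · rintro rfl
          exact ha hv
  exact key _

/-- This isometry is what extends the integral from simple functions to all `f` in `L²` of the
scalar measure of `x`. -/
theorem enorm_simpleIntegral (g : SimpleFunc ℂ ℂ) (x : H) :
    ‖E.simpleIntegral g x‖ₑ = eLpNorm g 2 (E.scalarMeasure x) := by
  have h1 : ∫⁻ z, ‖g z‖ₑ ^ 2 ∂(E.scalarMeasure x) = ‖E.simpleIntegral g x‖ₑ ^ 2 := by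
    have := SimpleFunc.lintegral_eq_lintegral (g.map (fun v => ‖v‖ₑ ^ 2)) (E.scalarMeasure x)
    rw [SimpleFunc.map_lintegral] at this
    simp only [SimpleFunc.map_apply] at this
    rw [this, ← ofReal_norm (E.simpleIntegral g x), ← ENNReal.ofReal_pow (norm_nonneg _),
      E.norm_simpleIntegral_sq, ENNReal.ofReal_sum_of_nonneg (fun _ _ => by positivity)]
    refine Finset.sum_congr rfl fun v _ => ?_
    rw [E.scalarMeasure_apply (g.measurableSet_fiber v), ENNReal.ofReal_mul (by positivity),
      ENNReal.ofReal_pow (norm_nonneg _), ENNReal.ofReal_pow (norm_nonneg _), ofReal_norm,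
      ofReal_norm]
  rw [eLpNorm_eq_lintegral_rpow_enorm_toReal (by norm_num) (by norm_num)]
  simp only [ENNReal.toReal_ofNat, ENNReal.rpow_ofNat]
  rw [h1, ← ENNReal.rpow_natCast, ← ENNReal.rpow_mul]
  norm_num

/-! ### Integrals of measurable functions -/

/-- The vectors `x` with `f` square integrable against the scalar measure of `x`. -/
def integralDomain (f : ℂ → ℂ) : Submodule ℂ H where
  carrier := {x | MemLp f 2 (E.scalarMeasure x)}
  add_mem' := by
    intro x y hx hy
    refine MemLp.of_measure_le_smul (by norm_num) (E.scalarMeasure_add_le x y) ?_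
    refine ⟨hx.1.add_measure hy.1, ?_⟩
    rw [eLpNorm_lt_top_iff_lintegral_rpow_enorm_lt_top (by norm_num) (by norm_num),
      lintegral_add_measure]
    exact ENNReal.add_lt_top.2
      ⟨lintegral_rpow_enorm_lt_top_of_eLpNorm_lt_top (by norm_num) (by norm_num) hx.2,
        lintegral_rpow_enorm_lt_top_of_eLpNorm_lt_top (by norm_num) (by norm_num) hy.2⟩
  zero_mem' := by
    have : E.scalarMeasure 0 = 0 := by
      rw [← Measure.measure_univ_eq_zero, scalarMeasure_univ]
      simp
    simp [this]
  smul_mem' := by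
    intro a x hx
    have h := E.scalarMeasure_smul a x
    exact MemLp.of_measure_le_smul (c := ‖a‖ₑ ^ 2) (ENNReal.pow_ne_top enorm_ne_top) h.le hx

theorem mem_integralDomain {f : ℂ → ℂ} {x : H} :
    x ∈ E.integralDomain f ↔ MemLp f 2 (E.scalarMeasure x) := Iff.rfl

/-- The vectors `E({|f| ≤ n}) x` lie in the domain, since `f` is bounded on the support of their
scalar measures, and they converge to `x`. -/
theorem dense_integralDomain {f : ℂ → ℂ} (hf : Measurable f) :
    Dense (E.integralDomain f : Set H) := by
  intro x
  let s : ℕ → Set ℂ := fun n => {z | ‖f z‖ ≤ n}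
  have hs : ∀ n, MeasurableSet (s n) := fun n => measurableSet_le hf.norm measurable_const
  refine mem_closure_of_tendsto (f := fun n => E.proj (s n) x) (b := atTop) ?_
    (Eventually.of_forall fun n => ?_)
  · have h1 : Tendsto (fun n => E.scalarMeasure x (s n)ᶜ) atTop (𝓝 0) := by
      have h2 : ⋂ n, (s n)ᶜ = ∅ := by
        rw [← compl_iUnion, compl_empty_iff, eq_univ_iff_forall]
        intro z
        obtain ⟨n, hn⟩ := exists_nat_ge ‖f z‖
        exact mem_iUnion.2 ⟨n, hn⟩
      rw [← measure_empty (μ := E.scalarMeasure x), ← h2]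
      refine tendsto_measure_iInter_atTop (fun n => (hs n).compl.nullMeasurableSet) ?_
        ⟨0, measure_ne_top _ _⟩
      intro m n hmn
      refine compl_subset_compl.2 fun z hz => ?_
      exact le_trans (show ‖f z‖ ≤ m from hz) (by exact_mod_cast hmn)
    rw [tendsto_iff_edist_tendsto_0]
    have h3 : ∀ n, edist (E.proj (s n) x) x = (E.scalarMeasure x (s n)ᶜ) ^ (1 / 2 : ℝ) := by
      intro n
      rw [E.scalarMeasure_apply (hs n).compl, E.proj_compl (hs n), edist_comm, edist_eq_enorm_sub,
        ← ENNReal.rpow_natCast, ← ENNReal.rpow_mul]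
      norm_num
    simp only [h3]
    have := h1.ennrpow_const (1 / 2 : ℝ)
    simpa using this
  · refine E.mem_integralDomain.2 ?_
    rw [E.scalarMeasure_proj (hs n)]
    refine MemLp.of_bound hf.aestronglyMeasurable n ?_
    exact ae_restrict_of_forall_mem (hs n) fun z hz => hz

/-- Simple functions approximating `f` in `L²` of every scalar measure. -/
def approx {f : ℂ → ℂ} (hf : Measurable f) (n : ℕ) : SimpleFunc ℂ ℂ :=
  SimpleFunc.approxOn f hf (range f ∪ {0}) 0 (by simp) n

theorem norm_approx_le {f : ℂ → ℂ} (hf : Measurable f) (n : ℕ) (z : ℂ) :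
    ‖approx hf n z‖ ≤ ‖f z‖ + ‖f z‖ :=
  SimpleFunc.norm_approxOn_zero_le hf _ z n

theorem tendsto_approx {f : ℂ → ℂ} (hf : Measurable f) (z : ℂ) :
    Tendsto (fun n => approx hf n z) atTop (𝓝 (f z)) :=
  SimpleFunc.tendsto_approxOn hf _ (subset_closure (by simp))

theorem tendsto_eLpNorm_approx_sub {f : ℂ → ℂ} (hf : Measurable f) {μ : Measure ℂ}
    (h : MemLp f 2 μ) : Tendsto (fun n => eLpNorm (⇑(approx hf n) - f) 2 μ) atTop (𝓝 0) :=
  SimpleFunc.tendsto_approxOn_range_Lp_eLpNorm (by norm_num) hf h.2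

theorem edist_simpleIntegral (g h : SimpleFunc ℂ ℂ) (x : H) :
    edist (E.simpleIntegral g x) (E.simpleIntegral h x) =
      eLpNorm (⇑g - ⇑h) 2 (E.scalarMeasure x) := by
  rw [edist_eq_enorm_sub, ← _root_.sub_apply, ← E.simpleIntegral_sub,
    E.enorm_simpleIntegral]
  rfl

theorem exists_tendsto_simpleIntegral_approx {f : ℂ → ℂ} (hf : Measurable f) {x : H}
    (hx : x ∈ E.integralDomain f) :
    ∃ y, Tendsto (fun n => E.simpleIntegral (approx hf n) x) atTop (𝓝 y) := by
  refine cauchySeq_tendsto_of_complete ?_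
  rw [EMetric.cauchySeq_iff]
  intro ε hε
  have h := tendsto_eLpNorm_approx_sub hf (E.mem_integralDomain.1 hx)
  have h' : ∀ᶠ n in atTop, eLpNorm (⇑(approx hf n) - f) 2 (E.scalarMeasure x) < ε / 2 :=
    h.eventually (gt_mem_nhds (ENNReal.half_pos hε.ne'))
  obtain ⟨N, hN⟩ := eventually_atTop.1 h'
  refine ⟨N, fun m hm n hn => ?_⟩
  rw [E.edist_simpleIntegral]
  have h1 : (⇑(approx hf m) - ⇑(approx hf n)) =
      (⇑(approx hf m) - f) + (f - ⇑(approx hf n)) := by simp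
  have hsm : ∀ k, AEStronglyMeasurable (⇑(approx hf k)) (E.scalarMeasure x) :=
    fun k => (approx hf k).aestronglyMeasurable
  calc eLpNorm (⇑(approx hf m) - ⇑(approx hf n)) 2 (E.scalarMeasure x)
      ≤ eLpNorm (⇑(approx hf m) - f) 2 (E.scalarMeasure x)
        + eLpNorm (f - ⇑(approx hf n)) 2 (E.scalarMeasure x) := by
        rw [h1]
        exact eLpNorm_add_le ((hsm m).sub hf.aestronglyMeasurable)
          (hf.aestronglyMeasurable.sub (hsm n)) (by norm_num)
    _ < ε / 2 + ε / 2 := by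
        refine ENNReal.add_lt_add (hN m hm) ?_
        rw [eLpNorm_sub_comm]
        exact hN n hn
    _ = ε := ENNReal.add_halves ε

/-- The operator `∫ f dE`. -/
def integral {f : ℂ → ℂ} (hf : Measurable f) : H →ₗ.[ℂ] H where
  domain := E.integralDomain f
  toFun :=
    { toFun := fun x => (E.exists_tendsto_simpleIntegral_approx hf x.2).choose
      map_add' := by
        intro x y
        have hx := (E.exists_tendsto_simpleIntegral_approx hf x.2).choose_spec
        have hy := (E.exists_tendsto_simpleIntegral_approx hf y.2).choose_spec
        have hxy := (E.exists_tendsto_simpleIntegral_approx hf (x + y).2).choose_spec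
        refine tendsto_nhds_unique hxy ((hx.add hy).congr fun n => ?_)
        simp
      map_smul' := by
        intro a x
        have hx := (E.exists_tendsto_simpleIntegral_approx hf x.2).choose_spec
        have hax := (E.exists_tendsto_simpleIntegral_approx hf (a • x).2).choose_spec
        refine tendsto_nhds_unique hax ((hx.const_smul a).congr fun n => ?_)
        simp }

variable {f : ℂ → ℂ} (hf : Measurable f)

theorem tendsto_simpleIntegral_approx (x : (E.integral hf).domain) :
    Tendsto (fun n => E.simpleIntegral (approx hf n) (x : H)) atTop (𝓝 (E.integral hf x)) :=
  (E.exists_tendsto_simpleIntegral_approx hf x.2).choose_spec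

/-- The isometry for simple functions, passed to the limit. Taking `g` constant later gives `‖B x -
a x‖` as an `L²` norm. -/
theorem edist_integral (x : (E.integral hf).domain) (g : SimpleFunc ℂ ℂ) :
    edist (E.integral hf x) (E.simpleIntegral g (x : H)) =
      eLpNorm (f - ⇑g) 2 (E.scalarMeasure (x : H)) := by
  have hx : MemLp f 2 (E.scalarMeasure (x : H)) := x.2
  have h1 := (E.tendsto_simpleIntegral_approx hf x).edist
    (tendsto_const_nhds (x := E.simpleIntegral g (x : H)))
  simp only [E.edist_simpleIntegral] at h1
  refine tendsto_nhds_unique h1 ?_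
  have hg : MemLp g 2 (E.scalarMeasure (x : H)) := g.memLp_of_isFiniteMeasure _ _
  have hn : ∀ n, MemLp (approx hf n) 2 (E.scalarMeasure (x : H)) :=
    fun n => SimpleFunc.memLp_of_isFiniteMeasure _ _ _
  have h2 : Tendsto (fun n => (hn n).toLp _) atTop (𝓝 (hx.toLp f)) := by
    rw [tendsto_iff_edist_tendsto_0]
    simp only [Lp.edist_toLp_toLp]
    exact tendsto_eLpNorm_approx_sub hf hx
  have h3 := h2.edist (tendsto_const_nhds (x := hg.toLp _))
  simpa only [Lp.edist_toLp_toLp] using h3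

theorem enorm_integral (x : (E.integral hf).domain) :
    ‖E.integral hf x‖ₑ = eLpNorm f 2 (E.scalarMeasure (x : H)) := by
  have := E.edist_integral hf x 0
  have h0 : E.simpleIntegral 0 (x : H) = 0 := by
    rw [← enorm_eq_zero, E.enorm_simpleIntegral]
    simp
  rw [h0, edist_zero_right] at this
  simpa using this

theorem isIntegral_integral : E.IsIntegral f (E.integral hf) := by
  refine ⟨fun x => Iff.rfl, fun x => ?_⟩
  have hx : MemLp f 2 (E.scalarMeasure (x : H)) := x.2
  have h1 := (tendsto_const_nhds (x := (x : H))).inner (𝕜 := ℂ) (E.tendsto_simpleIntegral_approx hf x)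
  simp only [E.inner_simpleIntegral] at h1
  refine tendsto_nhds_unique h1 ?_
  have hi : Integrable f (E.scalarMeasure (x : H)) := hx.integrable (by norm_num)
  refine tendsto_integral_of_dominated_convergence (fun z => ‖f z‖ + ‖f z‖)
    (fun n => (approx hf n).aestronglyMeasurable) (hi.norm.add hi.norm)
    (fun n => Eventually.of_forall fun z => norm_approx_le hf n z)
    (Eventually.of_forall fun z => tendsto_approx hf z)

variable {E}

/-- `IsIntegral` prescribes only the domain and the quadratic form; density of the domain and
polarization recover the operator. -/
theorem IsIntegral.eq_integral {B : H →ₗ.[ℂ] H} (hB : E.IsIntegral f B) :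
    B = E.integral hf := by
  have hd : B.domain = (E.integral hf).domain := by
    ext x
    exact hB.1 x
  refine LinearPMap.eq_of_inner_self_eq hd ?_ fun x h1 h2 => ?_
  · rw [hd]
    exact E.dense_integralDomain hf
  · rw [hB.2 ⟨x, h1⟩, (E.isIntegral_integral hf).2 ⟨x, h2⟩]

theorem IsIntegral.enorm_apply_sub_smul {B : H →ₗ.[ℂ] H} (hB : E.IsIntegral f B)
    (hf : Measurable f) (a : ℂ) (x : B.domain) :
    ‖B x - a • (x : H)‖ₑ = eLpNorm (fun z => f z - a) 2 (E.scalarMeasure (x : H)) := by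
  obtain rfl := hB.eq_integral hf
  have h := E.edist_integral hf x (SimpleFunc.const ℂ a)
  have h1 : E.simpleIntegral (SimpleFunc.const ℂ a) = a • 1 := by
    have := E.simpleIntegral_map (SimpleFunc.const ℂ (0 : ℂ)) (fun _ => a)
    rw [SimpleFunc.map_const] at this
    rw [this, SimpleFunc.range_const]
    have h0 : (0 : ℂ → ℂ) ⁻¹' {0} = univ := by ext; simp
    simp [h0, E.proj_univ]
  rw [h1, edist_eq_enorm_sub] at h
  exact h

end SpectralMeasure

/-- Approximate eigenvalues of a partially defined operator. -/
def LinearPMap.HasApproximateEigenvalue {H : Type*} [NormedAddCommGroup H]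
    [InnerProductSpace ℂ H] (A : H →ₗ.[ℂ] H) (a : ℂ) : Prop :=
  ∀ ε : ℝ, 0 < ε → ∃ x : A.domain, ‖A x - a • (x : H)‖ < ε * ‖(x : H)‖

theorem IsInvertibleOperator.not_hasApproximateEigenvalue {H : Type*}
    [NormedAddCommGroup H] [InnerProductSpace ℂ H] {A : H →ₗ.[ℂ] H}
    (hA : IsInvertibleOperator A) : ¬ A.HasApproximateEigenvalue 0 := by
  intro h
  obtain ⟨B, -, hB⟩ := hA
  -- The summand `1` keeps the constant positive when `B = 0`.
  obtain ⟨x, hx⟩ := h (1 / (‖B‖ + 1)) (by positivity)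
  rw [zero_smul, sub_zero] at hx
  have h1 : ‖(x : H)‖ ≤ ‖B‖ * ‖A x‖ := by
    conv_lhs => rw [← hB x]
    exact B.le_opNorm _
  have h2 : ‖A x‖ * (‖B‖ + 1) < ‖(x : H)‖ := by
    rw [div_mul_eq_mul_div, one_mul, lt_div_iff₀ (by positivity)] at hx
    exact hx
  nlinarith [norm_nonneg (A x)]

namespace SpectralMeasure

variable {H : Type*} [NormedAddCommGroup H] [InnerProductSpace ℂ H] [CompleteSpace H]
  (E : SpectralMeasure H)

/-! ### The support of a spectral measure -/

theorem scalarMeasure_eq_zero {s : Set ℂ} (hs : MeasurableSet s) (h : E.proj s = 0) (x : H) :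
    E.scalarMeasure x s = 0 := by
  rw [E.scalarMeasure_apply hs, h]
  simp

theorem proj_ne_zero_mono {s t : Set ℂ} (hs : MeasurableSet s) (ht : MeasurableSet t)
    (hst : s ⊆ t) (h : E.proj s ≠ 0) : E.proj t ≠ 0 := by
  intro h0
  refine h ?_
  rw [← inter_eq_left.2 hst, E.proj_inter s t hs ht, h0, mul_zero]

theorem eLpNorm_const_scalarMeasure (a : ℝ) (x : H) :
    eLpNorm (fun _ : ℂ => a) 2 (E.scalarMeasure x) = ‖a‖ₑ * ‖x‖ₑ := by
  rw [eLpNorm_const' a (by norm_num) (by norm_num), E.scalarMeasure_univ, ← ENNReal.rpow_natCast,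
    ← ENNReal.rpow_mul]
  norm_num

variable {E} {f : ℂ → ℂ}

/-- If the projection onto `{|f - a| < ε}` vanishes, then `‖B x - a x‖ ≥ ε ‖x‖` on the domain;
otherwise vectors in its range are approximate eigenvectors. The left side does not involve `E`, so
different spectral measures representing the same operator can be compared. -/
theorem IsIntegral.hasApproximateEigenvalue_iff {B : H →ₗ.[ℂ] H} (hB : E.IsIntegral f B)
    (hf : Measurable f) (a : ℂ) :
    B.HasApproximateEigenvalue a ↔ ∀ ε : ℝ, 0 < ε → E.proj (f ⁻¹' Metric.ball a ε) ≠ 0 := by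
  constructor
  · intro h ε hε h0
    obtain ⟨x, hx⟩ := h ε hε
    have h1 := E.scalarMeasure_eq_zero (hf Metric.isOpen_ball.measurableSet) h0 (x : H)
    have h2 : ∀ᵐ z ∂(E.scalarMeasure (x : H)), ‖ε‖ ≤ ‖f z - a‖ := by
      have h3 : ∀ᵐ z ∂(E.scalarMeasure (x : H)), z ∉ f ⁻¹' Metric.ball a ε :=
        measure_eq_zero_iff_ae_notMem.1 h1
      filter_upwards [h3] with z hz
      rw [Real.norm_of_nonneg hε.le]
      simpa [dist_eq_norm] using hz
    have h4 := eLpNorm_mono_ae (p := 2) h2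
    rw [E.eLpNorm_const_scalarMeasure, ← hB.enorm_apply_sub_smul hf, ← enorm_norm (x : H),
      ← enorm_mul, enorm_le_iff_norm_le, Real.norm_of_nonneg (by positivity)] at h4
    exact absurd hx (not_lt.2 h4)
  · intro h ε hε
    -- The pointwise bound yields only a weak inequality; radius `ε / 2` makes it strict for `ε`.
    obtain ⟨y, hy⟩ : ∃ y, E.proj (f ⁻¹' Metric.ball a (ε / 2)) y ≠ 0 := by
      by_contra! hcon
      exact h (ε / 2) (by positivity) (ContinuousLinearMap.ext hcon)
    have hs : MeasurableSet (f ⁻¹' Metric.ball a (ε / 2)) := hf Metric.isOpen_ball.measurableSet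
    set s := f ⁻¹' Metric.ball a (ε / 2)
    set x := E.proj s y with hxdef
    have hae : ∀ᵐ z ∂(E.scalarMeasure x), ‖f z - a‖ ≤ ‖ε / 2‖ := by
      rw [hxdef, E.scalarMeasure_proj hs]
      refine ae_restrict_of_forall_mem hs fun z hz => ?_
      rw [Real.norm_of_nonneg (by positivity), ← dist_eq_norm]
      exact (Metric.mem_ball.1 hz).le
    have hxB : x ∈ B.domain := by
      rw [hB.1]
      refine MemLp.of_bound hf.aestronglyMeasurable (‖ε / 2‖ + ‖a‖) ?_
      filter_upwards [hae] with z hz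
      calc ‖f z‖ = ‖(f z - a) + a‖ := by simp
        _ ≤ ‖f z - a‖ + ‖a‖ := norm_add_le _ _
        _ ≤ _ := by gcongr
    refine ⟨⟨x, hxB⟩, ?_⟩
    have h4 := eLpNorm_mono_ae (p := 2) hae
    rw [E.eLpNorm_const_scalarMeasure, ← hB.enorm_apply_sub_smul hf a ⟨x, hxB⟩,
      ← enorm_norm x, ← enorm_mul, enorm_le_iff_norm_le, Real.norm_of_nonneg (by positivity)] at h4
    refine h4.trans_lt ?_
    have : 0 < ‖x‖ := norm_pos_iff.2 hy
    simp only
    nlinarith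

/-- The support of the spectral measure of `A` consists of approximate eigenvalues. -/
theorem IsIntegral.ae_mem_of_hasApproximateEigenvalue {A : H →ₗ.[ℂ] H} (hA : E.IsIntegral id A) {K : Set ℂ}
    (h : ∀ a, A.HasApproximateEigenvalue a → a ∈ K) (x : H) :
    ∀ᵐ z ∂(E.scalarMeasure x), z ∈ K := by
  -- Each point outside `K` has a ball of measure zero; by second countability these balls make the
  -- whole complement null.
  refine measure_null_of_locally_null _ fun a ha => ?_
  have h1 : ¬ A.HasApproximateEigenvalue a := fun hh => ha (h a hh)
  rw [hA.hasApproximateEigenvalue_iff measurable_id] at h1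
  push Not at h1
  obtain ⟨ε, hε, h2⟩ := h1
  exact ⟨Metric.ball a ε, mem_nhdsWithin_of_mem_nhds (Metric.ball_mem_nhds a hε),
    E.scalarMeasure_eq_zero Metric.isOpen_ball.measurableSet h2 x⟩

/-! ### Push-forward -/

variable (E)

/-- The push-forward of a spectral measure under a Borel map. -/
def map {g : ℂ → ℂ} (hg : Measurable g) : SpectralMeasure H where
  proj s := E.proj (g ⁻¹' s)
  isStarProjection s hs := E.isStarProjection _ (hg hs)
  proj_univ := by rw [preimage_univ, E.proj_univ]
  proj_inter s t hs ht := by rw [preimage_inter, E.proj_inter _ _ (hg hs) (hg ht)]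
  hasSum_proj s hs hd x := by
    rw [preimage_iUnion]
    exact E.hasSum_proj _ (fun n => hg (hs n)) (fun i j hij => (hd hij).preimage g) x

theorem scalarMeasure_map {g : ℂ → ℂ} (hg : Measurable g) (x : H) :
    (E.map hg).scalarMeasure x = (E.scalarMeasure x).map g := by
  ext s hs
  rw [Measure.map_apply hg hs, scalarMeasure_apply _ hs, scalarMeasure_apply _ (hg hs)]
  rfl

/-! ### Inverses -/

theorem proj_simpleIntegral {s : Set ℂ} (hs : MeasurableSet s) (g : SimpleFunc ℂ ℂ) (x : H) :
    E.proj s (E.simpleIntegral g x) = E.simpleIntegral g (E.proj s x) := by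
  simp only [simpleIntegral, _root_.sum_apply, map_sum, _root_.smul_apply, map_smul]
  refine Finset.sum_congr rfl fun v _ => ?_
  rw [E.proj_proj hs (g.measurableSet_fiber v), E.proj_proj (g.measurableSet_fiber v) hs,
    inter_comm]

theorem proj_integral {s : Set ℂ} (hs : MeasurableSet s) (hf : Measurable f)
    (x : (E.integral hf).domain) (hx : E.proj s x ∈ (E.integral hf).domain) :
    E.proj s (E.integral hf x) = E.integral hf ⟨E.proj s x, hx⟩ := by
  have h1 := ((E.proj s).continuous.tendsto _).comp (E.tendsto_simpleIntegral_approx hf x)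
  have h2 := E.tendsto_simpleIntegral_approx hf ⟨E.proj s x, hx⟩
  refine tendsto_nhds_unique h1 (h2.congr fun n => ?_)
  exact (E.proj_simpleIntegral hs _ _).symm

/-- Spectral projections commute with `∫ f dE`, so `‖E(s) B x‖ = ‖B E(s) x‖`, which the isometry
evaluates as an integral of `|f|²` over `s`. -/
theorem scalarMeasure_integral (hf : Measurable f) (x : (E.integral hf).domain) :
    E.scalarMeasure (E.integral hf x) =
      (E.scalarMeasure (x : H)).withDensity (fun z => ‖f z‖ₑ ^ 2) := by
  ext s hs
  have hx : MemLp f 2 (E.scalarMeasure (x : H)) := x.2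
  have hsx : E.proj s x ∈ (E.integral hf).domain := by
    refine E.mem_integralDomain.2 ?_
    rw [E.scalarMeasure_proj hs]
    exact hx.restrict s
  rw [withDensity_apply _ hs, E.scalarMeasure_apply hs, E.proj_integral hs hf x hsx,
    E.enorm_integral hf, E.scalarMeasure_proj hs,
    eLpNorm_eq_lintegral_rpow_enorm_toReal (by norm_num) (by norm_num)]
  simp only [ENNReal.toReal_ofNat, ENNReal.rpow_ofNat]
  rw [← ENNReal.rpow_natCast, ← ENNReal.rpow_mul]
  norm_num

/-- A weak form of multiplicativity of the calculus, obtained by approximating `g`. The bound on `g`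
supplies the dominating constant. -/
theorem inner_simpleIntegral_integral {g : ℂ → ℂ} (hg : Measurable g) {C : ℝ}
    (u : (E.integral hg).domain) (hC : ∀ᵐ z ∂(E.scalarMeasure (u : H)), ‖g z‖ ≤ C)
    (h : SimpleFunc ℂ ℂ) :
    ⟪(u : H), E.simpleIntegral h (E.integral hg u)⟫_ℂ =
      ∫ z, h z * g z ∂(E.scalarMeasure (u : H)) := by
  have h1 := (tendsto_const_nhds (x := (u : H))).inner (𝕜 := ℂ)
    (((E.simpleIntegral h).continuous.tendsto _).comp (E.tendsto_simpleIntegral_approx hg u))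
  refine tendsto_nhds_unique h1 ?_
  have h2 : ∀ n, ⟪(u : H), (E.simpleIntegral h ∘ fun n => E.simpleIntegral (approx hg n) (u : H)) n⟫_ℂ
      = ∫ z, h z * approx hg n z ∂(E.scalarMeasure (u : H)) := by
    intro n
    have := E.inner_simpleIntegral (h * approx hg n) (u : H)
    rw [E.simpleIntegral_mul] at this
    exact this
  simp only [h2]
  obtain ⟨D, hD⟩ := h.exists_forall_norm_le
  refine tendsto_integral_of_dominated_convergence (fun _ => D * (C + C))
    (fun n => (h.aestronglyMeasurable.mul (approx hg n).aestronglyMeasurable))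
    (integrable_const _) (fun n => ?_) (Eventually.of_forall fun z => ?_)
  · filter_upwards [hC] with z hz
    rw [norm_mul]
    have h3 := norm_approx_le hg n z
    have h4 := hD z
    have h5 := norm_nonneg (h z)
    exact mul_le_mul h4 (h3.trans (by gcongr)) (norm_nonneg _) (h5.trans h4)
  · exact (tendsto_approx hg z).const_mul _

variable {E}

/-- An integral of a function that is bounded away from `0` is invertible. -/
theorem IsIntegral.isInvertibleOperator {B : H →ₗ.[ℂ] H} (hB : E.IsIntegral f B)
    (hf : Measurable f) {δ : ℝ} (hδ : 0 < δ)
    (h : ∀ x, ∀ᵐ z ∂(E.scalarMeasure x), δ ≤ ‖f z‖) : IsInvertibleOperator B := by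
  have hg : Measurable (fun z => (f z)⁻¹) := hf.inv
  set g := fun z => (f z)⁻¹ with hgdef
  have hgb : ∀ x, ∀ᵐ z ∂(E.scalarMeasure x), ‖g z‖ ≤ δ⁻¹ := by
    intro x
    filter_upwards [h x] with z hz
    rw [hgdef]
    simp only [norm_inv]
    exact inv_anti₀ hδ hz
  have hdom : ∀ x, x ∈ (E.integral hg).domain := fun x =>
    MemLp.of_bound hg.aestronglyMeasurable _ (hgb x)
  -- The candidate inverse is `∫ f⁻¹ dE`, everywhere defined because `f⁻¹` is essentially bounded by
  -- `δ⁻¹`.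
  let G : H →ₗ[ℂ] H :=
    { toFun := fun x => E.integral hg ⟨x, hdom x⟩
      map_add' := fun x y => (E.integral hg).map_add ⟨x, hdom x⟩ ⟨y, hdom y⟩
      map_smul' := fun a x => (E.integral hg).map_smul a ⟨x, hdom x⟩ }
  have hGb : ∀ x, ‖G x‖ ≤ δ⁻¹ * ‖x‖ := by
    intro x
    have h1 : ∀ᵐ z ∂(E.scalarMeasure x), ‖g z‖ ≤ ‖δ⁻¹‖ := by
      rw [Real.norm_of_nonneg (by positivity)]
      exact hgb x
    have h4 := eLpNorm_mono_ae (p := 2) h1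
    rw [E.eLpNorm_const_scalarMeasure, ← E.enorm_integral hg ⟨x, hdom x⟩,
      ← enorm_norm x, ← enorm_mul, enorm_le_iff_norm_le, Real.norm_of_nonneg (by positivity)] at h4
    exact h4
  have hfg : ∀ x, ∀ᵐ z ∂(E.scalarMeasure x), f z * g z = 1 := by
    intro x
    filter_upwards [h x] with z hz
    exact mul_inv_cancel₀ (norm_pos_iff.1 (hδ.trans_le hz))
  have hnorm : ∀ u, eLpNorm f 2 (E.scalarMeasure (G u)) = ‖u‖ₑ := by
    intro u
    have h1 : E.scalarMeasure (G u) = _ := E.scalarMeasure_integral hg ⟨u, hdom u⟩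
    rw [h1, eLpNorm_eq_lintegral_rpow_enorm_toReal (by norm_num) (by norm_num)]
    simp only [ENNReal.toReal_ofNat, ENNReal.rpow_ofNat]
    rw [lintegral_withDensity_eq_lintegral_mul _ (hg.enorm.pow_const 2) (hf.enorm.pow_const 2)]
    have h2 : ∫⁻ z, ((fun z => ‖g z‖ₑ ^ 2) * fun z => ‖f z‖ₑ ^ 2) z ∂(E.scalarMeasure u) =
        ∫⁻ _, 1 ∂(E.scalarMeasure u) := by
      refine lintegral_congr_ae ?_
      filter_upwards [hfg u] with z hz
      simp only [Pi.mul_apply]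
      rw [← mul_pow, ← enorm_mul, mul_comm, hz]
      simp
    rw [h2, lintegral_one, E.scalarMeasure_univ, ← ENNReal.rpow_natCast, ← ENNReal.rpow_mul]
    norm_num
  have hGdom : ∀ u, G u ∈ (E.integral hf).domain := fun u =>
    E.mem_integralDomain.2 ⟨hf.aestronglyMeasurable, by rw [hnorm]; exact enorm_lt_top⟩
  obtain rfl := hB.eq_integral hf
  -- Equality case of Cauchy–Schwarz: a vector `v` with `‖v‖ = ‖u‖` and `⟪u, v⟫ = ‖u‖²` equals `u`,
  -- on expanding `‖v - u‖²`.
  have hinv : ∀ u, E.integral hf ⟨G u, hGdom u⟩ = u := by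
    intro u
    have h1 : ‖E.integral hf ⟨G u, hGdom u⟩‖ = ‖u‖ := by
      have := E.enorm_integral hf ⟨G u, hGdom u⟩
      rw [hnorm] at this
      simpa using congrArg ENNReal.toReal this
    have h2 : ⟪u, E.integral hf ⟨G u, hGdom u⟩⟫_ℂ = (‖u‖ : ℂ) ^ 2 := by
      have h3 := (tendsto_const_nhds (x := u)).inner (𝕜 := ℂ)
        (E.tendsto_simpleIntegral_approx hf ⟨G u, hGdom u⟩)
      have h4 : ∀ n, ⟪u, E.simpleIntegral (approx hf n) (G u)⟫_ℂ =
          ∫ z, approx hf n z * g z ∂(E.scalarMeasure u) := fun n =>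
        E.inner_simpleIntegral_integral hg ⟨u, hdom u⟩ (hgb u) _
      simp only [h4] at h3
      have h5 : Tendsto (fun n => ∫ z, approx hf n z * g z ∂(E.scalarMeasure u)) atTop
          (𝓝 (∫ z, f z * g z ∂(E.scalarMeasure u))) := by
        refine tendsto_integral_of_dominated_convergence (fun _ => 2)
          (fun n => ((approx hf n).aestronglyMeasurable.mul hg.aestronglyMeasurable))
          (integrable_const _) (fun n => ?_) (Eventually.of_forall fun z => ?_)
        · filter_upwards [hfg u] with z hz
          rw [norm_mul]
          calc _ ≤ (‖f z‖ + ‖f z‖) * ‖g z‖ := by gcongr; exact norm_approx_le hf n z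
            _ = 2 * ‖f z * g z‖ := by rw [norm_mul]; ring
            _ = 2 := by rw [hz]; simp
        · exact (tendsto_approx hf z).mul_const _
      rw [tendsto_nhds_unique h3 h5, integral_congr_ae (hfg u), integral_const, Measure.real,
        E.scalarMeasure_univ]
      simp
    have h6 : ‖E.integral hf ⟨G u, hGdom u⟩ - u‖ ^ 2 = 0 := by
      rw [norm_sub_sq (𝕜 := ℂ), h1, ← inner_conj_symm, h2]
      have : (starRingEnd ℂ) ((‖u‖ : ℂ) ^ 2) = ((‖u‖ ^ 2 : ℝ) : ℂ) := by simp
      rw [this]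
      simp only [RCLike.re_to_complex, Complex.ofReal_re]
      ring
    exact sub_eq_zero.1 (norm_eq_zero.1 (pow_eq_zero_iff (by norm_num) |>.1 h6))
  have hinj : ∀ x y : (E.integral hf).domain, E.integral hf x = E.integral hf y → x = y := by
    intro x y hxy
    have h1 : E.integral hf (x - y) = 0 := by rw [LinearPMap.map_sub, hxy, sub_self]
    have h2 := E.enorm_integral hf (x - y)
    rw [h1, enorm_zero] at h2
    have h3 : ∀ᵐ z ∂(E.scalarMeasure ((x - y : (E.integral hf).domain) : H)), ‖δ‖ ≤ ‖f z‖ := by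
      rw [Real.norm_of_nonneg hδ.le]
      exact h _
    have h4 := eLpNorm_mono_ae (p := 2) h3
    rw [← h2, E.eLpNorm_const_scalarMeasure, nonpos_iff_eq_zero, mul_eq_zero] at h4
    rcases h4 with h4 | h4
    · exact absurd (enorm_eq_zero.1 h4) hδ.ne'
    · exact sub_eq_zero.1 (Subtype.ext (enorm_eq_zero.1 h4))
  refine ⟨G.mkContinuous δ⁻¹ hGb, fun u => ⟨hGdom u, hinv u⟩, fun v => ?_⟩
  have := hinj _ _ (hinv (E.integral hf v))
  exact congrArg Subtype.val this

end SpectralMeasure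

/-! ### Multiplication operators on `L²` -/

section Multiplication

variable {α : Type*} [MeasurableSpace α] {ν : Measure α}

/-- Multiplication by the indicator function of a measurable set, as an operator on `L²`. -/
def indicatorOperator (ν : Measure α) {s : Set α} (hs : MeasurableSet s) :
    Lp ℂ 2 ν →L[ℂ] Lp ℂ 2 ν :=
  LinearMap.mkContinuous
    { toFun := fun f => ((Lp.memLp f).indicator hs).toLp _
      map_add' := by
        intro f g
        rw [← MemLp.toLp_add]
        refine MemLp.toLp_congr _ _ ?_
        filter_upwards [Lp.coeFn_add f g] with t ht
        by_cases hts : t ∈ s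
        · simpa [hts] using ht
        · simp [hts]
      map_smul' := by
        intro a f
        rw [RingHom.id_apply, ← MemLp.toLp_const_smul]
        refine MemLp.toLp_congr _ _ ?_
        filter_upwards [Lp.coeFn_smul a f] with t ht
        by_cases hts : t ∈ s
        · simpa [hts] using ht
        · simp [hts] } 1 (by
    intro f
    rw [one_mul]
    refine Lp.norm_le_norm_of_ae_le ?_
    filter_upwards [((Lp.memLp f).indicator hs).coeFn_toLp] with t ht
    simp only [LinearMap.coe_mk, AddHom.coe_mk]
    rw [ht]
    exact norm_indicator_le_norm_self _ _)

theorem coeFn_indicatorOperator {s : Set α} (hs : MeasurableSet s) (f : Lp ℂ 2 ν) :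
    indicatorOperator ν hs f =ᵐ[ν] s.indicator f :=
  ((Lp.memLp f).indicator hs).coeFn_toLp

theorem enorm_Lp_two_sq (f : Lp ℂ 2 ν) : ‖f‖ₑ ^ 2 = ∫⁻ t, ‖f t‖ₑ ^ 2 ∂ν := by
  rw [Lp.enorm_def, eLpNorm_eq_lintegral_rpow_enorm_toReal (by norm_num) (by norm_num)]
  simp only [ENNReal.toReal_ofNat, ENNReal.rpow_ofNat]
  rw [← ENNReal.rpow_natCast, ← ENNReal.rpow_mul]
  norm_num

theorem enorm_indicatorOperator_sq {s : Set α} (hs : MeasurableSet s) (f : Lp ℂ 2 ν) :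
    ‖indicatorOperator ν hs f‖ₑ ^ 2 = ν.withDensity (fun t => ‖f t‖ₑ ^ 2) s := by
  rw [enorm_Lp_two_sq, withDensity_apply _ hs, ← lintegral_indicator hs]
  refine lintegral_congr_ae ?_
  filter_upwards [coeFn_indicatorOperator hs f] with t ht
  rw [ht]
  by_cases hts : t ∈ s <;> simp [hts]

theorem isFiniteMeasure_withDensity_Lp (f : Lp ℂ 2 ν) :
    IsFiniteMeasure (ν.withDensity (fun t => ‖f t‖ₑ ^ 2)) :=
  ⟨by
    rw [withDensity_apply _ MeasurableSet.univ, Measure.restrict_univ, ← enorm_Lp_two_sq]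
    exact ENNReal.pow_lt_top enorm_lt_top⟩

theorem indicatorOperator_inter {s t : Set α} (hs : MeasurableSet s) (ht : MeasurableSet t)
    (f : Lp ℂ 2 ν) : indicatorOperator ν (hs.inter ht) f =
      indicatorOperator ν hs (indicatorOperator ν ht f) := by
  refine Lp.ext ?_
  filter_upwards [coeFn_indicatorOperator (hs.inter ht) f, coeFn_indicatorOperator ht f,
    coeFn_indicatorOperator hs (indicatorOperator ν ht f)] with z h1 h2 h3
  rw [h1, h3]
  by_cases hzs : z ∈ s <;> by_cases hzt : z ∈ t <;> simp [hzs, hzt, h2]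

theorem inner_indicatorOperator_left {s : Set α} (hs : MeasurableSet s) (f g : Lp ℂ 2 ν) :
    ⟪indicatorOperator ν hs f, g⟫_ℂ = ⟪f, indicatorOperator ν hs g⟫_ℂ := by
  rw [L2.inner_def, L2.inner_def]
  refine integral_congr_ae ?_
  filter_upwards [coeFn_indicatorOperator hs f, coeFn_indicatorOperator hs g] with z h1 h2
  rw [h1, h2]
  by_cases hzs : z ∈ s <;> simp [hzs]

theorem indicatorOperator_sub_sum {s : ℕ → Set α} (hs : ∀ n, MeasurableSet (s n))
    (hd : Pairwise (Function.onFun Disjoint s)) (F : Finset ℕ) (f : Lp ℂ 2 ν) :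
    indicatorOperator ν (MeasurableSet.iUnion hs) f - ∑ n ∈ F, indicatorOperator ν (hs n) f =
      indicatorOperator ν
        ((MeasurableSet.iUnion hs).diff (F.measurableSet_biUnion fun n _ => hs n)) f := by
  refine Lp.ext ?_
  have h0 : ∀ᵐ z ∂ν, ∀ n, indicatorOperator ν (hs n) f z = (s n).indicator f z :=
    ae_all_iff.2 fun n => coeFn_indicatorOperator (hs n) f
  filter_upwards [h0, coeFn_indicatorOperator (MeasurableSet.iUnion hs) f,
    coeFn_indicatorOperator
      ((MeasurableSet.iUnion hs).diff (F.measurableSet_biUnion fun n _ => hs n)) f,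
    Lp.coeFn_sub (indicatorOperator ν (MeasurableSet.iUnion hs) f)
      (∑ n ∈ F, indicatorOperator ν (hs n) f),
    Lp.coeFn_finsetSum F (fun n => indicatorOperator ν (hs n) f)] with z h1 h2 h3 h4 h5
  rw [h3, h4, Pi.sub_apply, h2, h5, Finset.sum_apply, Finset.sum_congr rfl fun n _ => h1 n]
  have h6 : ∑ n ∈ F, (s n).indicator f z = (⋃ n ∈ F, s n).indicator f z := by
    rw [Finset.indicator_biUnion_apply F s (fun i _ j _ hij => hd hij)]
  rw [h6]
  by_cases hF : z ∈ ⋃ n ∈ F, s n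
  · have hU : z ∈ ⋃ n, s n := iUnion₂_subset (fun n _ => subset_iUnion s n) hF
    rw [indicator_of_mem hU, indicator_of_mem hF, indicator_of_notMem (fun h => h.2 hF), sub_self]
  · by_cases hU : z ∈ ⋃ n, s n
    · rw [indicator_of_mem hU, indicator_of_notMem hF, indicator_of_mem (mem_sdiff_of_mem hU hF), sub_zero]
    · rw [indicator_of_notMem hU, indicator_of_notMem hF, indicator_of_notMem (fun h => hU h.1),
        sub_zero]

/-- The squared norm of the remainder is the mass of the uncovered part for the finite measure `|f|²
dν`. These parts decrease to `∅` along the finite sets of indices, so continuity from above applies.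
-/
theorem hasSum_indicatorOperator {s : ℕ → Set α} (hs : ∀ n, MeasurableSet (s n))
    (hd : Pairwise (Function.onFun Disjoint s)) (f : Lp ℂ 2 ν) :
    HasSum (fun n => indicatorOperator ν (hs n) f)
      (indicatorOperator ν (MeasurableSet.iUnion hs) f) := by
  have := isFiniteMeasure_withDensity_Lp f
  set μ := ν.withDensity (fun t => ‖f t‖ₑ ^ 2) with hμ
  have hm : ∀ F : Finset ℕ, MeasurableSet ((⋃ n, s n) \ ⋃ n ∈ F, s n) := fun F =>
    (MeasurableSet.iUnion hs).diff (F.measurableSet_biUnion fun n _ => hs n)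
  have h1 : Tendsto (fun F : Finset ℕ => μ ((⋃ n, s n) \ ⋃ n ∈ F, s n)) atTop (𝓝 0) := by
    have h2 : ⋂ F : Finset ℕ, ((⋃ n, s n) \ ⋃ n ∈ F, s n) = ∅ := by
      rw [eq_empty_iff_forall_notMem]
      intro z hz
      rw [mem_iInter] at hz
      obtain ⟨n, hn⟩ := mem_iUnion.1 (hz ∅).1
      exact (hz {n}).2 (by simpa using hn)
    rw [← measure_empty (μ := μ), ← h2]
    refine tendsto_measure_iInter_atTop (fun F => (hm F).nullMeasurableSet) ?_
      ⟨∅, measure_ne_top _ _⟩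
    intro F G hFG
    exact sdiff_subset_sdiff_right (biUnion_subset_biUnion_left hFG)
  rw [HasSum, SummationFilter.unconditional_filter, tendsto_iff_edist_tendsto_0]
  have h3 : ∀ F : Finset ℕ, edist (∑ n ∈ F, indicatorOperator ν (hs n) f)
      (indicatorOperator ν (MeasurableSet.iUnion hs) f) =
        (μ ((⋃ n, s n) \ ⋃ n ∈ F, s n)) ^ (1 / 2 : ℝ) := by
    intro F
    rw [edist_comm, edist_eq_enorm_sub, indicatorOperator_sub_sum hs hd, hμ,
      ← enorm_indicatorOperator_sq (hm F), ← ENNReal.rpow_natCast, ← ENNReal.rpow_mul]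
    norm_num
  simp only [h3]
  simpa using h1.ennrpow_const (1 / 2 : ℝ)

variable {H : Type*} [NormedAddCommGroup H] [InnerProductSpace ℂ H] [CompleteSpace H]

open Classical in
/-- The spectral measure of the operator that a unitary map `W` onto `L²` turns into the
multiplication by `m`. -/
def SpectralMeasure.ofMultiplication (W : H ≃ₗᵢ[ℂ] Lp ℂ 2 ν) {m : α → ℂ} (hm : Measurable m) :
    SpectralMeasure H where
  proj s := if hs : MeasurableSet s then
      (W.symm.toContinuousLinearEquiv : Lp ℂ 2 ν →L[ℂ] H) ∘L indicatorOperator ν (hm hs) ∘L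
        (W.toContinuousLinearEquiv : H →L[ℂ] Lp ℂ 2 ν)
    else 0
  isStarProjection s hs := by
    rw [dif_pos hs]
    constructor
    · ext x
      simp only [mul_apply_eq_comp, ContinuousLinearMap.comp_apply]
      simp [← indicatorOperator_inter]
    · rw [ContinuousLinearMap.isSelfAdjoint_iff_isSymmetric]
      intro x y
      simp only [ContinuousLinearMap.coe_coe, ContinuousLinearMap.comp_apply]
      have h1 := W.inner_map_map (W.symm (indicatorOperator ν (hm hs) (W x))) y
      have h2 := W.inner_map_map x (W.symm (indicatorOperator ν (hm hs) (W y)))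
      rw [W.apply_symm_apply] at h1 h2
      exact h1.symm.trans ((inner_indicatorOperator_left _ _ _).trans h2)
  proj_univ := by
    rw [dif_pos MeasurableSet.univ]
    ext x
    have h : indicatorOperator ν (hm MeasurableSet.univ) (W x) = W x := by
      refine Lp.ext ?_
      filter_upwards [coeFn_indicatorOperator (hm MeasurableSet.univ) (W x)] with z hz
      rw [hz]
      simp
    exact (congrArg W.symm h).trans (W.symm_apply_apply x)
  proj_inter s t hs ht := by
    rw [dif_pos hs, dif_pos ht, dif_pos (hs.inter ht)]
    ext x
    have h := indicatorOperator_inter (hm hs) (hm ht) (W x)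
    simpa using h
  hasSum_proj s hs hd x := by
    rw [dif_pos (MeasurableSet.iUnion hs)]
    simp only [dif_pos (hs _)]
    have h := (hasSum_indicatorOperator (fun n => hm (hs n)) (fun i j hij => (hd hij).preimage m)
      (W x)).mapL (W.symm.toContinuousLinearEquiv : Lp ℂ 2 ν →L[ℂ] H)
    simp only [← preimage_iUnion] at h
    exact h

theorem SpectralMeasure.scalarMeasure_ofMultiplication (W : H ≃ₗᵢ[ℂ] Lp ℂ 2 ν) {m : α → ℂ}
    (hm : Measurable m) (x : H) : (ofMultiplication W hm).scalarMeasure x =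
      (ν.withDensity (fun t => ‖W x t‖ₑ ^ 2)).map m := by
  ext s hs
  rw [scalarMeasure_apply _ hs, Measure.map_apply hm hs, ← enorm_indicatorOperator_sq (hm hs)]
  have : (ofMultiplication W hm).proj s x = W.symm (indicatorOperator ν (hm hs) (W x)) := by
    simp [ofMultiplication, hs]
  rw [this]
  congr 1
  rw [← enorm_norm, W.symm.norm_map, enorm_norm]

/-- The scalar measure of `x` is the push-forward under `m` of `|W x|² dν`, so both requirements are
changes of variables. -/
theorem SpectralMeasure.isIntegral_id_ofMultiplication (W : H ≃ₗᵢ[ℂ] Lp ℂ 2 ν) {m : α → ℂ}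
    (hm : Measurable m) {A : H →ₗ.[ℂ] H}
    (hd : ∀ x, x ∈ A.domain ↔ MemLp (fun t => m t * W x t) 2 ν)
    (hA : ∀ x : A.domain, W (A x) =ᵐ[ν] fun t => m t * W (x : H) t) :
    (ofMultiplication W hm).IsIntegral id A := by
  have hW : ∀ x, Measurable (fun t => ‖W x t‖ₑ ^ 2) := fun x =>
    (Lp.stronglyMeasurable (W x)).measurable.enorm.pow_const 2
  constructor
  · intro x
    rw [hd, scalarMeasure_ofMultiplication,
      memLp_map_measure_iff measurable_id.aestronglyMeasurable hm.aemeasurable, Function.id_comp]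
    have h1 : AEStronglyMeasurable (fun t => m t * W x t) ν :=
      hm.aestronglyMeasurable.mul (Lp.aestronglyMeasurable _)
    rw [MemLp, MemLp, and_iff_right h1, and_iff_right hm.aestronglyMeasurable,
      eLpNorm_lt_top_iff_lintegral_rpow_enorm_lt_top (by norm_num) (by norm_num),
      eLpNorm_lt_top_iff_lintegral_rpow_enorm_lt_top (by norm_num) (by norm_num)]
    simp only [ENNReal.toReal_ofNat, ENNReal.rpow_ofNat]
    rw [lintegral_withDensity_eq_lintegral_mul _ (hW x) (hm.enorm.pow_const 2)]
    simp only [Pi.mul_apply, enorm_mul, mul_pow, mul_comm]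
  · intro x
    rw [scalarMeasure_ofMultiplication, integral_map hm.aemeasurable
      measurable_id.aestronglyMeasurable, ← W.inner_map_map, L2.inner_def,
      integral_withDensity_eq_integral_toReal_smul (hW _)
        (Eventually.of_forall fun t => ENNReal.pow_lt_top enorm_lt_top)]
    refine integral_congr_ae ?_
    filter_upwards [hA x] with t ht
    rw [ht]
    simp only [id, RCLike.inner_apply, ENNReal.toReal_pow, toReal_enorm]
    rw [mul_assoc, RCLike.mul_conj, Complex.real_smul]
    push_cast
    exact mul_comm _ _

end Multiplication

/-! ### The Fourier transform on `L¹ ∩ L²` -/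

section Fourier

open FourierTransform SchwartzMap

/-- A function is determined almost everywhere by its pairings with Schwartz functions. -/
theorem ae_eq_of_integral_schwartz_smul_eq {f g : ℝ → ℂ} (hf : LocallyIntegrable f)
    (hg : LocallyIntegrable g)
    (h : ∀ ψ : 𝓢(ℝ, ℂ), ∫ x, ψ x • f x = ∫ x, ψ x • g x) : f =ᵐ[volume] g := by
  refine ae_eq_of_integral_contDiff_smul_eq hf hg fun ψ hψ hc => ?_
  have hc' : HasCompactSupport (fun x => (ψ x : ℂ)) :=
    hc.comp_left (g := fun r : ℝ => (r : ℂ)) Complex.ofReal_zero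
  have hs : ContDiff ℝ ((⊤ : ℕ∞) : WithTop ℕ∞) (fun x => (ψ x : ℂ)) :=
    Complex.ofRealCLM.contDiff.comp hψ
  have := h (hc'.toSchwartzMap hs)
  simpa [HasCompactSupport.toSchwartzMap_toFun] using this

theorem continuous_fourier_of_integrable {f : ℝ → ℂ} (hf : Integrable f) : Continuous (𝓕 f) :=
  VectorFourier.fourierIntegral_continuous Real.continuous_fourierChar
    (by simp only [innerₗ_apply_apply]; fun_prop) hf

theorem continuous_fourierInv_of_integrable {f : ℝ → ℂ} (hf : Integrable f) :
    Continuous (𝓕⁻ f) := by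
  have : 𝓕⁻ f = fun t => 𝓕 f (-t) := funext (Real.fourierInv_eq_fourier_neg f)
  rw [this]
  exact (continuous_fourier_of_integrable hf).comp continuous_neg

theorem locallyIntegrable_Lp_two (f : Lp ℂ 2 (volume : Measure ℝ)) : LocallyIntegrable f :=
  (Lp.memLp f).locallyIntegrable (by norm_num)

/-- The `L²` transform is compatible with tempered distributions, and the integral formula satisfies
the same duality with Schwartz functions by Fubini. -/
theorem fourier_Lp_ae_eq {f : ℝ → ℂ} (hf : Integrable f) (F : Lp ℂ 2 (volume : Measure ℝ))
    (hF : F =ᵐ[volume] f) : (𝓕 F : Lp ℂ 2 (volume : Measure ℝ)) =ᵐ[volume] 𝓕 f := by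
  refine ae_eq_of_integral_schwartz_smul_eq (locallyIntegrable_Lp_two _)
    (continuous_fourier_of_integrable hf).locallyIntegrable fun ψ => ?_
  rw [← Lp.toTemperedDistribution_apply, ← Lp.fourier_toTemperedDistribution_eq,
    TemperedDistribution.fourier_apply, Lp.toTemperedDistribution_apply, SchwartzMap.fourier_coe]
  have h1 : ∫ x, 𝓕 (⇑ψ) x • F x = ∫ x, 𝓕 (⇑ψ) x • f x := by
    refine integral_congr_ae ?_
    filter_upwards [hF] with x hx
    rw [hx]
  rw [h1]
  have h2 := VectorFourier.integral_fourierIntegral_smul_eq_flip (μ := volume) (ν := volume)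
    (L := innerₗ ℝ) Real.continuous_fourierChar (by simp only [innerₗ_apply_apply]; fun_prop)
    (ψ.integrable (μ := volume)) hf
  rw [flip_innerₗ] at h2
  exact h2

theorem fourierInv_Lp_ae_eq {f : ℝ → ℂ} (hf : Integrable f) (F : Lp ℂ 2 (volume : Measure ℝ))
    (hF : F =ᵐ[volume] f) : (𝓕⁻ F : Lp ℂ 2 (volume : Measure ℝ)) =ᵐ[volume] 𝓕⁻ f := by
  refine ae_eq_of_integral_schwartz_smul_eq (locallyIntegrable_Lp_two _)
    (continuous_fourierInv_of_integrable hf).locallyIntegrable fun ψ => ?_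
  rw [← Lp.toTemperedDistribution_apply, ← Lp.fourierInv_toTemperedDistribution_eq,
    TemperedDistribution.fourierInv_apply, Lp.toTemperedDistribution_apply,
    SchwartzMap.fourierInv_coe]
  have h1 : ∫ x, 𝓕⁻ (⇑ψ) x • F x = ∫ x, 𝓕⁻ (⇑ψ) x • f x := by
    refine integral_congr_ae ?_
    filter_upwards [hF] with x hx
    rw [hx]
  rw [h1]
  -- The inverse transform is the Fourier integral for the negated pairing, which is again
  -- symmetric.
  have h2 := VectorFourier.integral_fourierIntegral_smul_eq_flip (μ := volume) (ν := volume)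
    (L := -innerₗ ℝ) Real.continuous_fourierChar
    (by simp only [LinearMap.neg_apply, innerₗ_apply_apply]; fun_prop)
    (ψ.integrable (μ := volume)) hf
  have h3 : (-innerₗ ℝ).flip = -innerₗ ℝ := by
    ext
    simp
  rw [h3] at h2
  exact h2

/-! ### The Fourier transform of the derivative -/

/-- Write `h` as `(1 + iξ)⁻¹` times `(1 + iξ) h`, a product of two square integrable functions. -/
theorem integrable_of_memLp_mul {h : ℝ → ℂ} (h1 : MemLp h 2 volume)
    (h2 : MemLp (fun ξ : ℝ => (ξ : ℂ) * h ξ) 2 volume) : Integrable h := by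
  have h3 : MemLp (fun ξ : ℝ => (1 + Complex.I * ξ) * h ξ) 2 volume := by
    have := h1.add (h2.const_mul Complex.I)
    refine this.ae_eq (Eventually.of_forall fun ξ => ?_)
    simp only [Pi.add_apply]
    ring
  have hne : ∀ ξ : ℝ, (1 + Complex.I * ξ : ℂ) ≠ 0 := by
    intro ξ hξ
    have := congrArg Complex.re hξ
    simp at this
  have h4 : MemLp (fun ξ : ℝ => (1 + Complex.I * ξ : ℂ)⁻¹) 2 volume := by
    have hcont : Continuous (fun ξ : ℝ => (1 + Complex.I * ξ : ℂ)⁻¹) :=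
      Continuous.inv₀ (by fun_prop) hne
    rw [memLp_two_iff_integrable_sq_norm hcont.aestronglyMeasurable]
    refine integrable_inv_one_add_sq.congr (Eventually.of_forall fun ξ => ?_)
    simp only [norm_inv, inv_pow]
    rw [← Complex.normSq_eq_norm_sq, Complex.normSq_apply]
    simp
    ring
  have h5 := h4.integrable_mul h3
  refine h5.congr (Eventually.of_forall fun ξ => ?_)
  simp only [Pi.mul_apply]
  rw [← mul_assoc, inv_mul_cancel₀ (hne ξ), one_mul]

/-- The conjugate is the one produced by the inner product with an indicator function; multiplying
by `2πiξ` avoids a quotient at `ξ = 0`. -/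
theorem fourier_indicator_mul {a b : ℝ} (hab : a ≤ b) (ξ : ℝ) :
    (starRingEnd ℂ) (𝓕 ((Ioc a b).indicator (fun _ => (1 : ℂ))) ξ) * (2 * Real.pi * Complex.I * ξ) =
      Complex.exp (2 * Real.pi * Complex.I * ξ * b) - Complex.exp (2 * Real.pi * Complex.I * ξ * a) := by
  rcases eq_or_ne ξ 0 with rfl | hξ
  · simp
  have hc : (-(2 * Real.pi * Complex.I * ξ) : ℂ) ≠ 0 := by
    simp [hξ, Real.pi_ne_zero]
  have h1 : 𝓕 ((Ioc a b).indicator (fun _ => (1 : ℂ))) ξ =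
      ∫ v in a..b, Complex.exp (-(2 * Real.pi * Complex.I * ξ) * v) := by
    rw [Real.fourier_real_eq_integral_exp_smul, intervalIntegral.integral_of_le hab,
      ← integral_indicator measurableSet_Ioc]
    congr 1
    ext v
    by_cases hv : v ∈ Ioc a b
    · simp only [indicator_of_mem hv, smul_eq_mul, mul_one]
      congr 1
      push_cast
      ring
    · simp [indicator_of_notMem hv]
  rw [h1, integral_exp_mul_complex hc, map_div₀, map_sub, ← Complex.exp_conj, ← Complex.exp_conj]
  have h2 : (starRingEnd ℂ) (-(2 * Real.pi * Complex.I * ξ)) = 2 * Real.pi * Complex.I * ξ := by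
    simp [Complex.conj_ofNat]
  rw [map_mul, map_mul, h2, Complex.conj_ofReal, Complex.conj_ofReal]
  rw [div_mul_cancel₀]
  simpa using hc

/-- The left side is the inner product of `k` with the indicator of `(a, b]`. By Plancherel it moves
to the Fourier side, where the factor `2πiξ` cancels the denominator of the transformed indicator
and leaves two inversion integrals. -/
theorem setIntegral_eq_sub_fourierInv (y k : Lp ℂ 2 (volume : Measure ℝ))
    (hy : Integrable (𝓕 y : Lp ℂ 2 (volume : Measure ℝ)))
    (hk : (𝓕 k : Lp ℂ 2 (volume : Measure ℝ)) =ᵐ[volume]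
      fun ξ => 2 * Real.pi * Complex.I * ξ * (𝓕 y : Lp ℂ 2 (volume : Measure ℝ)) ξ)
    {a b : ℝ} (hab : a ≤ b) :
    ∫ t in a..b, k t = 𝓕⁻ (⇑(𝓕 y : Lp ℂ 2 (volume : Measure ℝ))) b -
      𝓕⁻ (⇑(𝓕 y : Lp ℂ 2 (volume : Measure ℝ))) a := by
  have hμ : volume (Ioc a b) ≠ ∞ := by simp
  set h := (𝓕 y : Lp ℂ 2 (volume : Measure ℝ))
  have h1 := L2.inner_indicatorConstLp_one (𝕜 := ℂ) measurableSet_Ioc hμ k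
  have hind : Integrable ((Ioc a b).indicator (fun _ => (1 : ℂ))) :=
    (integrable_indicator_iff measurableSet_Ioc).2 (integrableOn_const hμ)
  have h2 := fourier_Lp_ae_eq hind (indicatorConstLp 2 measurableSet_Ioc hμ (1 : ℂ))
    indicatorConstLp_coeFn
  rw [intervalIntegral.integral_of_le hab, ← h1, ← Lp.inner_fourier_eq, L2.inner_def]
  have h3 : ∀ b : ℝ, 𝓕⁻ (⇑h) b = ∫ ξ : ℝ, Complex.exp (2 * Real.pi * Complex.I * ξ * b) * h ξ := by
    intro b
    rw [Real.fourierInv_eq']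
    congr 1
    ext ξ
    rw [smul_eq_mul]
    congr 2
    simp
    ring
  have h4 : ∀ b : ℝ, Integrable (fun ξ : ℝ =>
      Complex.exp (2 * Real.pi * Complex.I * ξ * b) * h ξ) := by
    intro b
    refine hy.bdd_mul (c := 1) (Continuous.aestronglyMeasurable (by fun_prop))
      (Eventually.of_forall fun ξ => ?_)
    rw [show (2 * Real.pi * Complex.I * ξ * b : ℂ) = ((2 * Real.pi * ξ * b : ℝ) : ℂ) * Complex.I by
      push_cast; ring, Complex.norm_exp_ofReal_mul_I]
  rw [h3, h3, ← integral_sub (h4 b) (h4 a)]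
  refine integral_congr_ae ?_
  filter_upwards [h2, hk] with ξ e1 e2
  rw [e1, e2, RCLike.inner_apply, ← sub_mul, ← fourier_indicator_mul hab ξ]
  ring

/-! ### Absolute continuity of primitives -/

theorem MeasureTheory.LocallyIntegrable.intervalIntegrable {k : ℝ → ℂ}
    (hk : LocallyIntegrable k) (a b : ℝ) : IntervalIntegrable k volume a b :=
  (hk.integrableOn_isCompact isCompact_uIcc).intervalIntegrable

theorem absolutelyContinuousOnInterval_integral {u : ℝ → ℝ}
    (hu : ∀ a b, IntervalIntegrable u volume a b) (a b : ℝ) :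
    AbsolutelyContinuousOnInterval (fun t => ∫ s in (0 : ℝ)..t, u s) a b := by
  -- The interval is enlarged so as to contain the base point `0` of the primitive.
  have hle : min (min a b) 0 ≤ max (max a b) 0 := by simp
  have := (hu (min (min a b) 0) (max (max a b) 0)).absolutelyContinuousOnInterval_intervalIntegral
    (c := 0) (by rw [uIcc_of_le hle]; simp)
  refine this.mono ?_
  rw [uIcc_of_le hle]
  exact uIcc_subset_Icc ⟨by simp, by simp⟩ ⟨by simp, by simp⟩

theorem absolutelyContinuousOnInterval_const (w : ℂ) (a b : ℝ) :
    AbsolutelyContinuousOnInterval (fun _ => w) a b :=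
  LipschitzOnWith.absolutelyContinuousOnInterval (K := 0)
    ((LipschitzWith.const w).lipschitzOnWith)

theorem locallyAbsolutelyContinuous_integral {k : ℝ → ℂ} (hk : LocallyIntegrable k) (w : ℂ) :
    LocallyAbsolutelyContinuous (fun t => w + ∫ s in (0 : ℝ)..t, k s) := by
  intro a b
  have hre : ∀ t, ∫ s in (0 : ℝ)..t, (k s).re = (∫ s in (0 : ℝ)..t, k s).re := fun t =>
    Complex.reCLM.intervalIntegral_comp_comm (hk.intervalIntegrable 0 t)
  have him : ∀ t, ∫ s in (0 : ℝ)..t, (k s).im = (∫ s in (0 : ℝ)..t, k s).im := fun t =>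
    Complex.imCLM.intervalIntegral_comp_comm (hk.intervalIntegrable 0 t)
  have h1 := absolutelyContinuousOnInterval_integral (u := fun s => (k s).re)
    (fun a b => ⟨(hk.intervalIntegrable a b).1.re, (hk.intervalIntegrable a b).2.re⟩) a b
  have h2 := absolutelyContinuousOnInterval_integral (u := fun s => (k s).im)
    (fun a b => ⟨(hk.intervalIntegrable a b).1.im, (hk.intervalIntegrable a b).2.im⟩) a b
  have h3 := (absolutelyContinuousOnInterval_const w a b).add
    ((h1.smul (absolutelyContinuousOnInterval_const 1 a b)).add
      (h2.smul (absolutelyContinuousOnInterval_const Complex.I a b)))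
  convert! h3 using 1
  ext t
  simp only [Pi.add_apply, Pi.smul_apply', hre, him]
  simp [Complex.re_add_im]

/-- A square integrable function `y` with `ξ ↦ ξ (𝓕 y) ξ` square integrable is locally absolutely
continuous, with square integrable derivative. -/
theorem exists_locallyAbsolutelyContinuous_of_memLp (y : Lp ℂ 2 (volume : Measure ℝ))
    (hy : MemLp (fun ξ : ℝ => (ξ : ℂ) * (𝓕 y : Lp ℂ 2 (volume : Measure ℝ)) ξ) 2 volume) :
    ∃ (g : ℝ → ℂ) (k : Lp ℂ 2 (volume : Measure ℝ)), LocallyAbsolutelyContinuous g ∧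
      y =ᵐ[volume] g ∧ k =ᵐ[volume] deriv g ∧
      (𝓕 k : Lp ℂ 2 (volume : Measure ℝ)) =ᵐ[volume]
        fun ξ => 2 * Real.pi * Complex.I * ξ * (𝓕 y : Lp ℂ 2 (volume : Measure ℝ)) ξ := by
  set h := (𝓕 y : Lp ℂ 2 (volume : Measure ℝ)) with hh
  have hint : Integrable h := integrable_of_memLp_mul (Lp.memLp h) hy
  have hm : MemLp (fun ξ : ℝ => 2 * Real.pi * Complex.I * ξ * h ξ) 2 volume := by
    refine (hy.const_mul (2 * Real.pi * Complex.I)).ae_eq (Eventually.of_forall fun ξ => ?_)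
    simp only
    ring
  -- The future derivative is defined on the Fourier side; `𝓕⁻ h`, the continuous representative of
  -- `y`, turns out to be a primitive of it.
  let k : Lp ℂ 2 (volume : Measure ℝ) := 𝓕⁻ (hm.toLp _)
  have hk : (𝓕 k : Lp ℂ 2 (volume : Measure ℝ)) =ᵐ[volume]
      fun ξ => 2 * Real.pi * Complex.I * ξ * h ξ := by
    rw [fourier_fourierInv_eq]
    exact hm.coeFn_toLp
  have hkl := locallyIntegrable_Lp_two k
  have heq : 𝓕⁻ (⇑h) = fun t => 𝓕⁻ (⇑h) 0 + ∫ s in (0 : ℝ)..t, k s := by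
    ext t
    rcases le_total 0 t with ht | ht
    · rw [setIntegral_eq_sub_fourierInv y k hint hk ht]
      ring
    · rw [intervalIntegral.integral_symm, setIntegral_eq_sub_fourierInv y k hint hk ht]
      ring
  refine ⟨fun t => 𝓕⁻ (⇑h) 0 + ∫ s in (0 : ℝ)..t, k s, k,
    locallyAbsolutelyContinuous_integral hkl _, ?_, ?_, hk⟩
  · rw [← heq]
    have := fourierInv_Lp_ae_eq hint h (ae_eq_refl _)
    rwa [hh, fourierInv_fourier_eq] at this
  · filter_upwards [_root_.LocallyIntegrable.ae_hasDerivAt_integral hkl] with t ht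
    exact ((ht 0).const_add _).deriv.symm

/-! ### From the derivative to the Fourier side -/

theorem locallyAbsolutelyContinuous_exp (a : ℂ) :
    LocallyAbsolutelyContinuous (fun t : ℝ => Complex.exp (a * t)) := by
  intro x y
  refine ContDiffOn.absolutelyContinuousOnInterval ?_
  refine ContDiff.contDiffOn ?_
  exact (contDiff_const.mul Complex.ofRealCLM.contDiff).cexp

theorem LocallyAbsolutelyContinuous.mul {g k : ℝ → ℂ} (hg : LocallyAbsolutelyContinuous g)
    (hk : LocallyAbsolutelyContinuous k) : LocallyAbsolutelyContinuous (fun t => g t * k t) :=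
  fun a b => (hg a b).smul (hk a b)

theorem LocallyAbsolutelyContinuous.sub {g k : ℝ → ℂ} (hg : LocallyAbsolutelyContinuous g)
    (hk : LocallyAbsolutelyContinuous k) : LocallyAbsolutelyContinuous (g - k) :=
  fun a b => (hg a b).sub (hk a b)

theorem hasDerivAt_exp_mul {g : ℝ → ℂ} (a : ℂ) {t : ℝ} (hg : DifferentiableAt ℝ g t) :
    HasDerivAt (fun t : ℝ => Complex.exp (a * t) * g t)
      (Complex.exp (a * t) * (deriv g t + a * g t)) t := by
  have h1 : HasDerivAt (fun t : ℝ => Complex.exp (a * t)) (Complex.exp (a * t) * a) t := by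
    have h2 : HasDerivAt (fun t : ℝ => a * (t : ℂ)) a t := by
      simpa using (Complex.ofRealCLM.hasDerivAt (x := t)).const_mul a
    exact h2.cexp
  convert! h1.mul hg.hasDerivAt using 1
  ring

/-- The equation `w' = w` has no nonzero square integrable solution. -/
theorem LocallyAbsolutelyContinuous.eq_zero_of_deriv_eq {w : ℝ → ℂ}
    (hw : LocallyAbsolutelyContinuous w) (hd : deriv w =ᵐ[volume] w) (hL : MemLp w 2 volume) :
    w = 0 := by
  have hconst : ∀ t, w t = Complex.exp t * w 0 := by
    intro t
    -- The function `e^{-t} w` is absolutely continuous with derivative zero almost everywhere,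
    -- hence constant.
    have h1 := (locallyAbsolutelyContinuous_exp (-1)).mul hw 0 t
    obtain ⟨C, hC⟩ := h1.const_of_ae_hasDerivAt_zero (by
      filter_upwards [hw.ae_differentiableAt, hd] with s hs hs' _
      have := hasDerivAt_exp_mul (-1) hs
      rw [hs'] at this
      simpa using this)
    have h2 := (hC t right_mem_uIcc).trans (hC 0 left_mem_uIcc).symm
    simp only [Complex.ofReal_zero, mul_zero, Complex.exp_zero, one_mul] at h2
    rw [← h2, ← mul_assoc, ← Complex.exp_add]
    simp
  have h0 : w 0 = 0 := by
    -- On `[0, ∞)` one has `|w| ≥ |w 0|`, and only the constant `0` is square integrable there.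
    have h3 : MemLp (fun _ : ℝ => w 0) 2 (volume.restrict (Ici 0)) := by
      refine (hL.restrict (Ici 0)).of_le aestronglyMeasurable_const ?_
      refine ae_restrict_of_forall_mem measurableSet_Ici fun t ht => ?_
      rw [hconst t, norm_mul, Complex.norm_exp_ofReal]
      exact le_mul_of_one_le_left (norm_nonneg _) (Real.one_le_exp ht)
    rw [memLp_const_iff (by norm_num) (by norm_num)] at h3
    simpa using h3
  ext t
  rw [hconst t, h0]
  simp

/-- A resolvent argument replaces integration by parts. On the Fourier side `d/dt - 1` is
multiplication by `2πiξ - 1`, of modulus at least `1`, so some `y'` for which the formula is already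
known solves `(d/dt - 1) y' = k - y`. The difference of the two solutions satisfies `w' = w` in
`L²`, so it vanishes and `y' = y`. -/
theorem fourier_ae_eq_of_locallyAbsolutelyContinuous {g : ℝ → ℂ}
    (hg : LocallyAbsolutelyContinuous g) (y k : Lp ℂ 2 (volume : Measure ℝ))
    (hy : y =ᵐ[volume] g) (hk : k =ᵐ[volume] deriv g) :
    (𝓕 k : Lp ℂ 2 (volume : Measure ℝ)) =ᵐ[volume]
      fun ξ => 2 * Real.pi * Complex.I * ξ * (𝓕 y : Lp ℂ 2 (volume : Measure ℝ)) ξ := by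
  let r : Lp ℂ 2 (volume : Measure ℝ) := 𝓕 (k - y)
  have hne : ∀ ξ : ℝ, (2 * Real.pi * Complex.I * ξ - 1 : ℂ) ≠ 0 := by
    intro ξ hξ
    have := congrArg Complex.re hξ
    simp at this
  have hcont : Continuous (fun ξ : ℝ => (2 * Real.pi * Complex.I * ξ - 1 : ℂ)⁻¹) :=
    Continuous.inv₀ (by fun_prop) hne
  have hnorm : ∀ ξ : ℝ, 1 ≤ ‖(2 * Real.pi * Complex.I * ξ - 1 : ℂ)‖ := by
    intro ξ
    have := Complex.abs_re_le_norm (2 * Real.pi * Complex.I * ξ - 1 : ℂ)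
    simpa using this
  have hnorm' : ∀ ξ : ℝ, ‖(ξ : ℂ)‖ ≤ ‖(2 * Real.pi * Complex.I * ξ - 1 : ℂ)‖ := by
    intro ξ
    have := Complex.abs_im_le_norm (2 * Real.pi * Complex.I * ξ - 1 : ℂ)
    simp only [Complex.sub_im, Complex.mul_im, Complex.mul_re, Complex.I_im, Complex.I_re,
      Complex.ofReal_im, Complex.ofReal_re, Complex.re_ofNat, Complex.im_ofNat, Complex.one_im] at this
    rw [Complex.norm_real, Real.norm_eq_abs]
    refine le_trans ?_ this
    ring_nf
    rw [abs_mul, abs_mul, abs_of_pos Real.pi_pos]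
    have := Real.pi_gt_three
    have := abs_nonneg ξ
    norm_num
    nlinarith
  have hsm : AEStronglyMeasurable (fun ξ : ℝ => (2 * Real.pi * Complex.I * ξ - 1 : ℂ)⁻¹ * r ξ)
      volume := hcont.aestronglyMeasurable.mul (Lp.aestronglyMeasurable r)
  have hm : MemLp (fun ξ : ℝ => (2 * Real.pi * Complex.I * ξ - 1 : ℂ)⁻¹ * r ξ) 2 volume := by
    refine (Lp.memLp r).of_le hsm (Eventually.of_forall fun ξ => ?_)
    rw [norm_mul, norm_inv]
    exact mul_le_of_le_one_left (norm_nonneg _) (inv_le_one_of_one_le₀ (hnorm ξ))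
  let y' : Lp ℂ 2 (volume : Measure ℝ) := 𝓕⁻ (hm.toLp _)
  have hy' : (𝓕 y' : Lp ℂ 2 (volume : Measure ℝ)) =ᵐ[volume]
      fun ξ => (2 * Real.pi * Complex.I * ξ - 1 : ℂ)⁻¹ * r ξ := by
    rw [fourier_fourierInv_eq]
    exact hm.coeFn_toLp
  have hm' : MemLp (fun ξ : ℝ => (ξ : ℂ) * (𝓕 y' : Lp ℂ 2 (volume : Measure ℝ)) ξ) 2 volume := by
    refine (Lp.memLp r).of_le (Complex.continuous_ofReal.aestronglyMeasurable.mul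
      (Lp.aestronglyMeasurable _)) ?_
    filter_upwards [hy'] with ξ hξ
    rw [hξ, ← mul_assoc, norm_mul, norm_mul, norm_inv, ← div_eq_mul_inv]
    exact mul_le_of_le_one_left (norm_nonneg _)
      (div_le_one_of_le₀ (hnorm' ξ) (norm_nonneg _))
  obtain ⟨g', k', hg', hyg', hkg', hF⟩ := exists_locallyAbsolutelyContinuous_of_memLp y' hm'
  have hres : k' - y' = k - y := by
    have h1 : (𝓕 (k' - y') : Lp ℂ 2 (volume : Measure ℝ)) = r := by
      have h2 : (𝓕 (k' - y') : Lp ℂ 2 (volume : Measure ℝ)) = 𝓕 k' - 𝓕 y' :=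
        (Lp.fourierTransformₗᵢ ℝ ℂ).map_sub k' y'
      rw [h2]
      refine Lp.ext ?_
      filter_upwards [Lp.coeFn_sub (𝓕 k' : Lp ℂ 2 (volume : Measure ℝ)) (𝓕 y'), hF, hy']
        with ξ e1 e2 e3
      rw [e1, Pi.sub_apply, e2, e3, ← sub_one_mul, ← mul_assoc, mul_inv_cancel₀ (hne ξ), one_mul]
    exact (Lp.fourierTransformₗᵢ ℝ ℂ).injective h1
  have hw : g - g' = 0 := by
    refine (hg.sub hg').eq_zero_of_deriv_eq ?_ ?_
    · have e0 : k - k' = y - y' := by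
        rw [sub_eq_sub_iff_add_eq_add] at hres ⊢
        rw [add_comm y k', ← hres, add_comm]
      have e0' : ⇑(k - k') =ᵐ[volume] ⇑(y - y') := by rw [e0]
      filter_upwards [hg.ae_differentiableAt, hg'.ae_differentiableAt, hy, hk, hyg', hkg', e0',
        Lp.coeFn_sub k k', Lp.coeFn_sub y y'] with t d d' e1 e2 e3 e4 e5 e6 e7
      rw [deriv_sub d d', Pi.sub_apply, ← e1, ← e2, ← e3, ← e4]
      rw [e6, e7] at e5
      exact e5
    · refine (Lp.memLp (y - y')).ae_eq ?_
      filter_upwards [hy, hyg', Lp.coeFn_sub y y'] with t e1 e2 e3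
      rw [e3, Pi.sub_apply, e1, e2, Pi.sub_apply]
  have hyy : y' = y := by
    refine Lp.ext (hyg'.trans (EventuallyEq.trans ?_ hy.symm))
    rw [sub_eq_zero.1 hw]
  have hkk : k' = k := by
    rw [hyy] at hres
    exact sub_left_injective hres
  rw [← hyy, ← hkk]
  exact hF

end Fourier

/-! ### The spectral measure of the momentum operator -/

section Momentum

open FourierTransform

theorem eLpNorm_weightMeasure (c : ℝ) (f : ℝ → ℂ) :
    eLpNorm f 2 (weightMeasure c) =
      eLpNorm (fun t : ℝ => Complex.exp (-c * t) * f t) 2 volume := by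
  rw [eLpNorm_eq_lintegral_rpow_enorm_toReal (by norm_num) (by norm_num),
    eLpNorm_eq_lintegral_rpow_enorm_toReal (by norm_num) (by norm_num)]
  simp only [ENNReal.toReal_ofNat, ENNReal.rpow_ofNat]
  rw [weightMeasure, lintegral_withDensity_eq_lintegral_mul_non_measurable _ (by fun_prop)
    (Eventually.of_forall fun t => ENNReal.ofReal_lt_top)]
  congr 2
  ext t
  rw [Pi.mul_apply, enorm_mul, mul_pow, ← ofReal_norm (Complex.exp _), Complex.norm_exp,
    ← ENNReal.ofReal_pow (by positivity), ← Real.exp_nat_mul,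
    show -2 * c * t = (2 : ℕ) * (-(c : ℂ) * t).re by simp; ring]

theorem aestronglyMeasurable_weightMeasure_iff {c : ℝ} {f : ℝ → ℂ} :
    AEStronglyMeasurable f (weightMeasure c) ↔ AEStronglyMeasurable f volume :=
  ⟨fun h => h.mono_ac (absolutelyContinuous_weightMeasure c),
    fun h => h.mono_ac (weightMeasure_absolutelyContinuous c)⟩

theorem ae_weightMeasure {c : ℝ} : ae (weightMeasure c) = ae (volume : Measure ℝ) :=
  le_antisymm (weightMeasure_absolutelyContinuous c).ae_le
    (absolutelyContinuous_weightMeasure c).ae_le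

theorem memLp_exp_mul {c : ℝ} {f : ℝ → ℂ} (hf : MemLp f 2 (weightMeasure c)) :
    MemLp (fun t : ℝ => Complex.exp (-c * t) * f t) 2 volume :=
  ⟨(Continuous.aestronglyMeasurable (by fun_prop)).mul
    (aestronglyMeasurable_weightMeasure_iff.1 hf.1), by
    rw [← eLpNorm_weightMeasure]; exact hf.2⟩

/-- Multiplication by `e^{-ct}` is an isometry of `L²(ℝ, e^{-2ct} dt)` into `L²(ℝ)`. -/
def weightIsometry (c : ℝ) : WeightedSpace c →ₗᵢ[ℂ] Lp ℂ 2 (volume : Measure ℝ) where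
  toFun f := (memLp_exp_mul (Lp.memLp f)).toLp _
  map_add' f g := by
    rw [← MemLp.toLp_add]
    refine MemLp.toLp_congr _ _ ?_
    have := Lp.coeFn_add f g
    rw [EventuallyEq, ae_weightMeasure] at this
    filter_upwards [this] with t ht
    rw [ht]
    simp only [Pi.add_apply]
    ring
  map_smul' a f := by
    rw [RingHom.id_apply, ← MemLp.toLp_const_smul]
    refine MemLp.toLp_congr _ _ ?_
    have := Lp.coeFn_smul a f
    rw [EventuallyEq, ae_weightMeasure] at this
    filter_upwards [this] with t ht
    rw [ht]
    simp only [Pi.smul_apply, smul_eq_mul]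
    ring
  norm_map' f := by
    simp only [LinearMap.coe_mk, AddHom.coe_mk]
    rw [Lp.norm_toLp, ← eLpNorm_weightMeasure]
    rfl

theorem coeFn_weightIsometry (c : ℝ) (f : WeightedSpace c) :
    weightIsometry c f =ᵐ[volume] fun t : ℝ => Complex.exp (-c * t) * f t :=
  (memLp_exp_mul (Lp.memLp f)).coeFn_toLp

theorem weightIsometry_surjective (c : ℝ) : Function.Surjective (weightIsometry c) := by
  intro g
  have hexp : ∀ t : ℝ, Complex.exp (-c * t) * (Complex.exp (c * t) * g t) = g t := by
    intro t
    rw [← mul_assoc, ← Complex.exp_add]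
    simp
  have hm : MemLp (fun t : ℝ => Complex.exp (c * t) * g t) 2 (weightMeasure c) := by
    refine ⟨aestronglyMeasurable_weightMeasure_iff.2
      ((Continuous.aestronglyMeasurable (by fun_prop)).mul (Lp.aestronglyMeasurable g)), ?_⟩
    rw [eLpNorm_weightMeasure]
    simp only [hexp]
    exact (Lp.memLp g).2
  refine ⟨hm.toLp _, Lp.ext ?_⟩
  have h1 := hm.coeFn_toLp
  rw [EventuallyEq, ae_weightMeasure] at h1
  filter_upwards [coeFn_weightIsometry c (hm.toLp _), h1] with t e1 e2
  rw [e1, e2, hexp]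

/-- The unitary map that diagonalizes the momentum operator. -/
def momentumUnitary (c : ℝ) : WeightedSpace c ≃ₗᵢ[ℂ] Lp ℂ 2 (volume : Measure ℝ) :=
  (LinearIsometryEquiv.ofSurjective (weightIsometry c) (weightIsometry_surjective c)).trans
    (Lp.fourierTransformₗᵢ ℝ ℂ)

theorem momentumUnitary_apply (c : ℝ) (x : WeightedSpace c) :
    momentumUnitary c x = 𝓕 (weightIsometry c x) := rfl

/-- Conjugation removes the constant: `(e^{-ct} f)' = e^{-ct} (f' - c f)`. -/
theorem fourier_weightIsometry_of_mem_shiftGraph {c : ℝ} {x v : WeightedSpace c}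
    (h : (x, v) ∈ shiftGraph c) :
    momentumUnitary c (v - (c : ℂ) • x) =ᵐ[volume]
      fun ξ => 2 * Real.pi * Complex.I * ξ * momentumUnitary c x ξ := by
  obtain ⟨f, hf, hx, hv⟩ := h
  simp only at hx hv
  rw [momentumUnitary_apply, momentumUnitary_apply]
  refine fourier_ae_eq_of_locallyAbsolutelyContinuous
    ((locallyAbsolutelyContinuous_exp (-c)).mul hf) _ _ ?_ ?_
  · rw [EventuallyEq, ae_weightMeasure] at hx
    filter_upwards [coeFn_weightIsometry c x, hx] with t e1 e2
    rw [e1, e2]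
  · have h1 := Lp.coeFn_sub v ((c : ℂ) • x)
    have h2 := Lp.coeFn_smul (c : ℂ) x
    rw [EventuallyEq, ae_weightMeasure] at hx hv h1 h2
    filter_upwards [coeFn_weightIsometry c (v - (c : ℂ) • x), hx, hv, h1, h2,
      hf.ae_differentiableAt] with t e1 e2 e3 e4 e5 e6
    rw [e1, e4, Pi.sub_apply, e5, Pi.smul_apply, e2, e3, (hasDerivAt_exp_mul (-c) e6).deriv]
    simp only [smul_eq_mul]
    ring

theorem exists_mem_shiftGraph {c : ℝ} {x : WeightedSpace c}
    (h : MemLp (fun ξ : ℝ => (ξ : ℂ) * momentumUnitary c x ξ) 2 volume) :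
    ∃ v, (x, v) ∈ shiftGraph c := by
  obtain ⟨g, k, hg, hxg, hkg, -⟩ := exists_locallyAbsolutelyContinuous_of_memLp
    (weightIsometry c x) h
  obtain ⟨u, rfl⟩ := weightIsometry_surjective c k
  have hexp : ∀ (t : ℝ) (z : ℂ), Complex.exp (c * t) * (Complex.exp (-c * t) * z) = z := by
    intro t z
    rw [← mul_assoc, ← Complex.exp_add]
    simp
  -- With `f = e^{ct} g` one has `f' = e^{ct} g' + c f`, and `u` is the class of `e^{ct} g'`.
  refine ⟨u + (c : ℂ) • x, fun t => Complex.exp (c * t) * g t,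
    (locallyAbsolutelyContinuous_exp c).mul hg, ?_, ?_⟩
  · rw [EventuallyEq, ae_weightMeasure]
    filter_upwards [coeFn_weightIsometry c x, hxg] with t e1 e2
    rw [← e2, e1, hexp]
  · have h1 := Lp.coeFn_add u ((c : ℂ) • x)
    have h2 := Lp.coeFn_smul (c : ℂ) x
    rw [EventuallyEq, ae_weightMeasure] at h1 h2 ⊢
    filter_upwards [h1, h2, coeFn_weightIsometry c x, coeFn_weightIsometry c u, hxg, hkg,
      hg.ae_differentiableAt] with t e1 e2 e3 e4 e5 e6 e7
    rw [(hasDerivAt_exp_mul c e7).deriv, ← e6, ← e5, e1, Pi.add_apply, e2, e3, e4, mul_add, hexp,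
      mul_left_comm, hexp]
    rfl

theorem mem_domain_momentumOperator {c : ℝ} {x : WeightedSpace c} :
    x ∈ (momentumOperator c).domain ↔ x ∈ (infinitesimalShift c).domain := by
  simp [momentumOperator, LinearPMap.sub_domain, scalarOperator]

theorem momentumOperator_apply {c : ℝ} (x : (momentumOperator c).domain)
    (hx : (x : WeightedSpace c) ∈ (infinitesimalShift c).domain) :
    momentumOperator c x =
      Complex.I⁻¹ • (infinitesimalShift c ⟨x, hx⟩ - (c : ℂ) • (x : WeightedSpace c)) := rfl

/-- The momentum operator has a spectral measure, carried over from the multiplication by `2πξ`. -/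
theorem isIntegral_momentumOperator (c : ℝ) {m : ℝ → ℂ} (hm : Measurable m)
    (hm' : ∀ ξ, m ξ = 2 * Real.pi * ξ) :
    (SpectralMeasure.ofMultiplication (momentumUnitary c) hm).IsIntegral id
      (momentumOperator c) := by
  have key : ∀ (x : WeightedSpace c) (v : WeightedSpace c), (x, v) ∈ shiftGraph c →
      momentumUnitary c (Complex.I⁻¹ • (v - (c : ℂ) • x)) =ᵐ[volume]
        fun ξ => m ξ * momentumUnitary c x ξ := by
    intro x v h
    rw [map_smul]
    filter_upwards [fourier_weightIsometry_of_mem_shiftGraph h,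
      Lp.coeFn_smul Complex.I⁻¹ (momentumUnitary c (v - (c : ℂ) • x))] with ξ e1 e2
    rw [e2, Pi.smul_apply, e1, hm', smul_eq_mul]
    field_simp
  have hgraph : ∀ (x : WeightedSpace c) (hx : x ∈ (infinitesimalShift c).domain),
      (x, infinitesimalShift c ⟨x, hx⟩) ∈ shiftGraph c := by
    intro x hx
    rw [← infinitesimalShift_graph]
    exact (infinitesimalShift c).mem_graph ⟨x, hx⟩
  refine SpectralMeasure.isIntegral_id_ofMultiplication _ hm (fun x => ?_) (fun x => ?_)
  · rw [mem_domain_momentumOperator]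
    constructor
    · intro hx
      exact (Lp.memLp _).ae_eq (key x _ (hgraph x hx))
    · intro h
      have h' : MemLp (fun ξ : ℝ => (ξ : ℂ) * momentumUnitary c x ξ) 2 volume := by
        refine (h.const_mul (2 * Real.pi : ℂ)⁻¹).ae_eq (Eventually.of_forall fun ξ => ?_)
        simp only [hm']
        have : (Real.pi : ℂ) ≠ 0 := by exact_mod_cast Real.pi_ne_zero
        field_simp
      obtain ⟨v, hv⟩ := exists_mem_shiftGraph h'
      rw [← infinitesimalShift_graph] at hv
      exact LinearPMap.mem_domain_of_mem_graph hv
  · have hx := mem_domain_momentumOperator.1 x.2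
    rw [momentumOperator_apply x hx]
    exact key _ _ (hgraph _ hx)

theorem exists_isIntegral_momentumOperator (c : ℝ) :
    ∃ E : SpectralMeasure (WeightedSpace c), E.IsIntegral id (momentumOperator c) :=
  ⟨_, isIntegral_momentumOperator c (m := fun ξ : ℝ => 2 * Real.pi * ξ) (by fun_prop)
    fun _ => rfl⟩

/-- Every real number is in the spectrum of the momentum operator. -/
theorem hasApproximateEigenvalue_momentumOperator (c t : ℝ) :
    (momentumOperator c).HasApproximateEigenvalue t := by
  have hm : Measurable (fun ξ : ℝ => (2 * Real.pi * ξ : ℂ)) := by fun_prop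
  have hE := isIntegral_momentumOperator c hm fun _ => rfl
  rw [hE.hasApproximateEigenvalue_iff measurable_id]
  intro ε hε h0
  rw [preimage_id] at h0
  have hpi : (0 : ℝ) < 2 * Real.pi := by positivity
  -- Multiplication by `2π` maps this ball into the `ε`-ball about `t`; its indicator, of positive
  -- norm, is the test vector.
  set s := Metric.ball (t / (2 * Real.pi)) (ε / (2 * Real.pi)) with hs
  have hsub : s ⊆ (fun ξ : ℝ => (2 * Real.pi * ξ : ℂ)) ⁻¹' Metric.ball (t : ℂ) ε := by
    intro ξ hξ
    rw [hs, Metric.mem_ball, Real.dist_eq] at hξ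
    rw [mem_preimage, Metric.mem_ball, dist_eq_norm,
      show (2 * Real.pi * ξ - t : ℂ) = ((2 * Real.pi * (ξ - t / (2 * Real.pi)) : ℝ) : ℂ) by
        push_cast
        have : (Real.pi : ℂ) ≠ 0 := by exact_mod_cast Real.pi_ne_zero
        field_simp, Complex.norm_real, Real.norm_eq_abs, abs_mul, abs_of_pos hpi]
    rwa [lt_div_iff₀' hpi] at hξ
  have hvol : volume s ≠ 0 := (Metric.measure_ball_pos _ _ (by positivity)).ne'
  have hvol' : volume s ≠ ∞ := measure_ball_lt_top.ne
  let f : Lp ℂ 2 (volume : Measure ℝ) := indicatorConstLp 2 measurableSet_ball hvol' (1 : ℂ)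
  have h1 := SpectralMeasure.scalarMeasure_eq_zero _ Metric.isOpen_ball.measurableSet h0
    ((momentumUnitary c).symm f)
  rw [SpectralMeasure.scalarMeasure_ofMultiplication,
    Measure.map_apply hm Metric.isOpen_ball.measurableSet] at h1
  have h2 := measure_mono_null hsub h1
  rw [withDensity_apply _ measurableSet_ball, LinearIsometryEquiv.apply_symm_apply] at h2
  have h3 : ∫⁻ ξ in s, ‖f ξ‖ₑ ^ 2 = ∫⁻ _ in s, 1 := by
    refine setLIntegral_congr_fun_ae measurableSet_ball ?_
    filter_upwards [indicatorConstLp_coeFn (p := 2) (hs := measurableSet_ball)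
      (hμs := hvol') (c := (1 : ℂ))] with ξ h4 h5
    rw [h4, indicator_of_mem h5]
    simp
  rw [h3] at h2
  exact hvol (by simpa using h2)

end Momentum

/-! ### Truncations -/

section Truncation

/-- The spectral measure hidden in the conclusion is the one picked by choice, not necessarily the
one supplied by `hA`. -/
theorem isFunctionOf_functionalCalculus {H : Type*} [NormedAddCommGroup H]
    [InnerProductSpace ℂ H] [CompleteSpace H] {A : H →ₗ.[ℂ] H} {f : ℂ → ℂ} (hf : Measurable f)
    (hA : ∃ E : SpectralMeasure H, E.IsIntegral id A) :
    IsFunctionOf A f (functionalCalculus A f) := by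
  obtain ⟨E, hE⟩ := hA
  have h : ∃ B, IsFunctionOf A f B := ⟨E.integral hf, E, hE, E.isIntegral_integral hf⟩
  rw [functionalCalculus, dif_pos h]
  exact h.choose_spec

theorem measurable_riemannZeta : Measurable riemannZeta :=
  measurable_of_continuousOn_compl_singleton 1 fun _ hs =>
    (differentiableAt_riemannZeta hs).continuousAt.continuousWithinAt

/-- On a compact set without zeros, possibly containing the pole, `ζ` is bounded away from `0`. -/
theorem exists_pos_le_norm_riemannZeta {K : Set ℂ} (hK : IsCompact K)
    (h : ∀ s ∈ K, riemannZeta s ≠ 0) : ∃ δ > 0, ∀ s ∈ K, δ ≤ ‖riemannZeta s‖ := by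
  refine hK.induction_on (p := fun S => ∃ δ > 0, ∀ s ∈ S, δ ≤ ‖riemannZeta s‖) ⟨1, by simp⟩ ?_ ?_ ?_
  · rintro S T hST ⟨δ, hδ, hT⟩
    exact ⟨δ, hδ, fun s hs => hT s (hST hs)⟩
  · rintro S T ⟨δ, hδ, hS⟩ ⟨η, hη, hT⟩
    refine ⟨min δ η, lt_min hδ hη, ?_⟩
    rintro s (hs | hs)
    · exact (min_le_left _ _).trans (hS s hs)
    · exact (min_le_right _ _).trans (hT s hs)
  · intro a ha
    have hpos : 0 < ‖riemannZeta a‖ := norm_pos_iff.2 (h a ha)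
    rcases eq_or_ne a 1 with rfl | h1
    -- The residue at `1` is `1`, so `|ζ| > 1/2` on a punctured neighbourhood of the pole. The value
    -- assigned at `1` itself, nonzero by `h`, enters through the minimum.
    · have h2 : ∀ᶠ s in 𝓝[≠] (1 : ℂ), 1 / 2 < ‖(s - 1) * riemannZeta s‖ :=
        (riemannZeta_residue_one.norm).eventually (lt_mem_nhds (by norm_num))
      have h3 : ∀ᶠ s in 𝓝[≠] (1 : ℂ), ‖s - 1‖ < 1 := by
        refine mem_nhdsWithin_of_mem_nhds ?_
        filter_upwards [Metric.ball_mem_nhds (1 : ℂ) one_pos] with s hs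
        rwa [← dist_eq_norm]
      have h4 : ∀ᶠ s in 𝓝[≠] (1 : ℂ), min (1 / 2) ‖riemannZeta 1‖ ≤ ‖riemannZeta s‖ := by
        filter_upwards [h2, h3] with s e1 e2
        rw [norm_mul] at e1
        refine (min_le_left _ _).trans (e1.le.trans ?_)
        exact mul_le_of_le_one_left (norm_nonneg _) e2.le
      have h5 : ∀ᶠ s in 𝓝 (1 : ℂ), min (1 / 2) ‖riemannZeta 1‖ ≤ ‖riemannZeta s‖ := by
        rw [eventually_nhdsWithin_iff] at h4
        filter_upwards [h4] with s hs
        rcases eq_or_ne s 1 with rfl | hs1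
        · exact min_le_right _ _
        · exact hs hs1
      exact ⟨_, mem_nhdsWithin_of_mem_nhds h5, _, lt_min (by norm_num) hpos, fun s hs => hs⟩
    · have h2 : ∀ᶠ s in 𝓝 a, ‖riemannZeta a‖ / 2 < ‖riemannZeta s‖ :=
        ((differentiableAt_riemannZeta h1).continuousAt.norm).eventually
          (lt_mem_nhds (by linarith))
      exact ⟨_, mem_nhdsWithin_of_mem_nhds h2, _, half_pos hpos, fun s hs => le_of_lt hs⟩

variable {c T : ℝ} {φ : ℝ → ℝ}

theorem IsAdmissibleCutoff.mem_Icc (hφ : IsAdmissibleCutoff c T φ) (t : ℝ) :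
    φ t ∈ Icc (-T) T := by
  rw [← hφ.2.1]
  exact subset_closure (mem_range_self t)

theorem IsAdmissibleCutoff.measurable_truncation (hφ : IsAdmissibleCutoff c T φ) :
    Measurable (fun z : ℂ => (c + Complex.I * φ z.re : ℂ)) := by
  have := hφ.1
  exact Continuous.measurable (by fun_prop)

/-- The truncated shift is the integral of `c + i φ` against a spectral measure of `V_c`. -/
theorem IsAdmissibleCutoff.exists_isIntegral_truncatedShift (hφ : IsAdmissibleCutoff c T φ) :
    ∃ E : SpectralMeasure (WeightedSpace c), E.IsIntegral id (momentumOperator c) ∧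
      (E.map hφ.measurable_truncation).IsIntegral id (truncatedShift c φ) := by
  have hφc := hφ.1
  have hmeas : Measurable (fun z : ℂ => (φ z.re : ℂ)) := Continuous.measurable (by fun_prop)
  obtain ⟨E, hV, hB⟩ := isFunctionOf_functionalCalculus hmeas (exists_isIntegral_momentumOperator c)
  refine ⟨E, hV, ?_⟩
  have hb : ∀ z : ℂ, ‖(φ z.re : ℂ)‖ ≤ T := fun z => by
    rw [Complex.norm_real, Real.norm_eq_abs]
    exact abs_le.2 (hφ.mem_Icc z.re)
  have hmem : ∀ x, MemLp (fun z : ℂ => (φ z.re : ℂ)) 2 (E.scalarMeasure x) := fun x =>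
    MemLp.of_bound hmeas.aestronglyMeasurable T (Eventually.of_forall hb)
  have hBdom : ∀ x, x ∈ (functionalCalculus (momentumOperator c)
      (fun z => (φ z.re : ℂ))).domain := fun x => (hB.1 x).2 (hmem x)
  constructor
  · intro x
    rw [E.scalarMeasure_map, memLp_map_measure_iff measurable_id.aestronglyMeasurable
      hφ.measurable_truncation.aemeasurable, Function.id_comp]
    refine iff_of_true ?_ ?_
    · simpa [truncatedShift, LinearPMap.add_domain, scalarOperator] using hBdom x
    · exact (memLp_const (c : ℂ)).add ((hmem x).const_mul Complex.I)
  · intro x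
    have h1 : truncatedShift c φ x = (c : ℂ) • (x : WeightedSpace c) + Complex.I •
      functionalCalculus (momentumOperator c) (fun z => (φ z.re : ℂ)) ⟨x, hBdom x⟩ := rfl
    have hi : Integrable (fun z : ℂ => (φ z.re : ℂ)) (E.scalarMeasure (x : WeightedSpace c)) :=
      (hmem _).integrable (by norm_num)
    rw [E.scalarMeasure_map, integral_map hφ.measurable_truncation.aemeasurable
      measurable_id.aestronglyMeasurable, h1, inner_add_right, inner_smul_right, inner_smul_right,
      hB.2 ⟨x, hBdom x⟩]
    simp only [id]
    rw [integral_add (integrable_const _) (hi.const_mul _), integral_const_mul, integral_const,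
      Measure.real, E.scalarMeasure_univ, inner_self_eq_norm_sq_to_K]
    congr 1
    rw [Complex.real_smul, mul_comm]
    simp

/-- Spectral mapping: balls off the closed segment have empty preimage under `z ↦ c + iφ(Re z)`,
while a ball about a point of the segment has an open preimage meeting `ℝ`, the spectrum of `V_c`.
-/
theorem IsAdmissibleCutoff.hasApproximateEigenvalue_truncatedShift_iff
    (hφ : IsAdmissibleCutoff c T φ) (a : ℂ) :
    (truncatedShift c φ).HasApproximateEigenvalue a ↔ a ∈ {c} ×ℂ Icc (-T) T := by
  obtain ⟨E, hV, hE⟩ := hφ.exists_isIntegral_truncatedShift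
  have hφc := hφ.1
  have hproj : ∀ ε, (E.map hφ.measurable_truncation).proj (id ⁻¹' Metric.ball a ε) =
      E.proj ((fun z : ℂ => (c + Complex.I * φ z.re : ℂ)) ⁻¹' Metric.ball a ε) := fun _ => rfl
  rw [hE.hasApproximateEigenvalue_iff measurable_id]
  simp only [hproj]
  constructor
  · intro h
    have hcl : IsClosed ({c} ×ℂ Icc (-T) T) := isClosed_singleton.reProdIm isClosed_Icc
    by_contra ha
    obtain ⟨ε, hε, hball⟩ := Metric.isOpen_iff.1 hcl.isOpen_compl a ha
    refine h ε hε ?_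
    rw [show (fun z : ℂ => (c + Complex.I * φ z.re : ℂ)) ⁻¹' Metric.ball a ε = ∅ from ?_,
      E.proj_empty]
    rw [eq_empty_iff_forall_notMem]
    intro z hz
    refine hball hz ?_
    rw [Complex.mem_reProdIm]
    simpa using hφ.mem_Icc z.re
  · intro ha ε hε
    rw [Complex.mem_reProdIm] at ha
    obtain ⟨hre, him⟩ := ha
    rw [← hφ.2.1] at him
    obtain ⟨_, ⟨t, rfl⟩, ht⟩ := Metric.mem_closure_iff.1 him ε hε
    have hopen : IsOpen ((fun z : ℂ => (c + Complex.I * φ z.re : ℂ)) ⁻¹' Metric.ball a ε) :=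
      Metric.isOpen_ball.preimage (by fun_prop)
    have hmem : (t : ℂ) ∈ (fun z : ℂ => (c + Complex.I * φ z.re : ℂ)) ⁻¹' Metric.ball a ε := by
      rw [mem_preimage, Metric.mem_ball, dist_eq_norm, Complex.ofReal_re,
        show (c + Complex.I * φ t - a : ℂ) = ((φ t - a.im : ℝ) : ℂ) * Complex.I from ?_,
        norm_mul, Complex.norm_I, mul_one, Complex.norm_real, ← dist_eq_norm, dist_comm]
      · exact ht
      · apply Complex.ext
        · simp [mem_singleton_iff.1 hre]
        · simp
    obtain ⟨η, hη, hball⟩ := Metric.isOpen_iff.1 hopen _ hmem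
    have h1 := (hV.hasApproximateEigenvalue_iff measurable_id _).1
      (hasApproximateEigenvalue_momentumOperator c t) η hη
    exact E.proj_ne_zero_mono Metric.isOpen_ball.measurableSet hopen.measurableSet hball h1

/-! ### Invertibility of the truncated spectral operators -/

theorem IsAdmissibleCutoff.isFunctionOf_truncatedSpectralOperator
    (hφ : IsAdmissibleCutoff c T φ) :
    IsFunctionOf (truncatedShift c φ) riemannZeta (truncatedSpectralOperator c φ) := by
  obtain ⟨E, -, hE⟩ := hφ.exists_isIntegral_truncatedShift
  exact isFunctionOf_functionalCalculus measurable_riemannZeta ⟨_, hE⟩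

theorem IsAdmissibleCutoff.isInvertibleOperator_truncatedSpectralOperator
    (hφ : IsAdmissibleCutoff c T φ) (h : ∀ s : ℂ, s.re = c → riemannZeta s ≠ 0) :
    IsInvertibleOperator (truncatedSpectralOperator c φ) := by
  obtain ⟨E, hA, hB⟩ := hφ.isFunctionOf_truncatedSpectralOperator
  obtain ⟨δ, hδ, hK⟩ := exists_pos_le_norm_riemannZeta
    (K := {c} ×ℂ Icc (-T) T) (isCompact_singleton.reProdIm isCompact_Icc) fun s hs =>
      h s (Complex.mem_reProdIm.1 hs).1
  refine hB.isInvertibleOperator measurable_riemannZeta hδ fun x => ?_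
  -- Whatever spectral measure was chosen for the truncated shift, it is carried by the segment.
  filter_upwards [hA.ae_mem_of_hasApproximateEigenvalue
    (fun a => (hφ.hasApproximateEigenvalue_truncatedShift_iff a).1) x] with z hz
  exact hK z hz

theorem IsAdmissibleCutoff.not_isInvertibleOperator_truncatedSpectralOperator
    (hφ : IsAdmissibleCutoff c T φ) {s : ℂ} (hs : s ∈ {c} ×ℂ Icc (-T) T)
    (h0 : riemannZeta s = 0) : ¬ IsInvertibleOperator (truncatedSpectralOperator c φ) := by
  intro hinv
  obtain ⟨E, hA, hB⟩ := hφ.isFunctionOf_truncatedSpectralOperator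
  refine hinv.not_hasApproximateEigenvalue ?_
  rw [hB.hasApproximateEigenvalue_iff measurable_riemannZeta]
  intro ε hε
  -- Continuity of `ζ` at `s` is needed; nonvanishing for `Re s ≥ 1` covers the assigned value at
  -- `1` too.
  have hs1 : s ≠ 1 := by
    rintro rfl
    exact riemannZeta_ne_zero_of_one_le_re (by simp) h0
  have hnhds : riemannZeta ⁻¹' Metric.ball 0 ε ∈ 𝓝 s :=
    (differentiableAt_riemannZeta hs1).continuousAt.preimage_mem_nhds
      (by rw [h0]; exact Metric.ball_mem_nhds 0 hε)
  obtain ⟨η, hη, hball⟩ := Metric.mem_nhds_iff.1 hnhds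
  have h1 := (hA.hasApproximateEigenvalue_iff measurable_id s).1
    ((hφ.hasApproximateEigenvalue_truncatedShift_iff s).2 hs) η hη
  exact E.proj_ne_zero_mono Metric.isOpen_ball.measurableSet
    (measurable_riemannZeta Metric.isOpen_ball.measurableSet) hball h1

end Truncation

end

theorem theorem5p5 (c : ℝ) (hc : 0 ≤ c) (φ : ℝ → ℝ → ℝ)
    (hφ : ∀ T : ℝ, 0 < T → IsAdmissibleCutoff c T (φ T)) :
    IsQuasiInvertible c φ ↔ ∀ s : ℂ, s.re = c → riemannZeta s ≠ 0 := by
  constructor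
  · intro h s hs h0
    -- Any positive `T ≥ |Im s|` puts `s` on the segment; adding `1` ensures positivity for real
    -- `s`.
    have hT : 0 < |s.im| + 1 := by positivity
    refine (hφ _ hT).not_isInvertibleOperator_truncatedSpectralOperator (s := s) ?_ h0 (h _ hT)
    rw [Complex.mem_reProdIm]
    exact ⟨hs, abs_le.1 (by linarith)⟩
  · intro h T hT
    exact (hφ T hT).isInvertibleOperator_truncatedSpectralOperator h
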